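/- **Setting.** Let $\mathbf A$ be a finite alphabet and $\mathcal B\subset\mathbf A^2$ a transition set such that the subshift of finite type $\Sigma=\{(a_i)\in\mathbf A^{\mathbb Z} : (a_i,a_{i+1})\in\mathcal B\ \forall i\}$ is topologically mixing and uses all letters of $\mathbf A$. Put $I(a)=[0,1]\times\{a\}$ for $a\in\mathbf A$. Let $r\in(1,+\infty]$ and let $g$ be a $C^r$ expanding map of type $\Sigma$: its domain is a disjoint union $\bigsqcup_{(a_0,a_1)\in\mathcal B} I(a_0,a_1)$ of compact intervals $I(a_0,a_1)\subset I(a_0)$, and each restriction $g|_{I(a_0,a_1)}$ is a $C^r$-diffeomorphism onto $I(a_1)$ with $|Dg|>1$ (for non-integer $r$, $C^r$ means $C^{\lfloor r\rfloor}$ with $(r-\lfloor r\rfloor)$-Hölder derivative of order $\lfloor r\rfloor$). The associated regular Cantor set is $K=\bigcap_{n\ge0}g^{-n}\bigl(\bigsqcup_{\mathcal B} I(a_0,a_1)\bigr)$. A word is a non-empty finite sequence $\underline c=(c_0,\dots,c_n)$ with $(c_i,c_{i+1})\in\mathcal B$ for all $i<n$; writing $f_{(a_0,a_1)}=(g|_{I(a_0,a_1)})^{-1}$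 and $f_{\underline c}=f_{(c_0,c_1)}\circ\dots\circ f_{(c_{n-1},c_n)}$ (the identity if $n=0$), put $I(\underline c)=f_{\underline c}(I(c_n))\subset I(c_0)$. Let $K'$ be a second regular Cantor set, with data $\mathbf A',\mathcal B',r',g',I'$ of the same kind. Fix a constant $\kappa>1$, letters $a\in\mathbf A$, $a'\in\mathbf A'$ and $C^1$-embeddings $h:I(a)\to\mathbb R$, $h':I'(a')\to\mathbb R$ (so that $\tilde K=h(K\cap I(a))$ and $\tilde K'=h'(K'\cap I'(a'))$ are differentiable embeddings of $K$, $K'$). For $\rho\in(0,1)$ let $\tilde\Sigma(\rho)$ be the set of words $\underline c$ beginning with $a$ such that $\kappa^{-1}\rho\le|I(\underline c)|\le \kappa\rho$, and define $\tilde\Sigma'(\rho)$ analogously with $a'$. The $\rho$-rectangles of $\tilde K\times\tilde K'$ are the sets $h(I(\underline c))\times h'(I'(\underline c'))$ with $(\underline c,\underline c')\in\tilde\Sigma(\rho)\times\tilde\Sigma'(\rho)$; let $\mathcal R(\rho)$ be the set of them, indexed by these pairs of words. For $s\in\mathbb R$ let $\pi_s(x,y)=x-sy$ and $$N_\rho(s)=\#\{(Q,\tilde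 Q)\in\mathcal R(\rho)\times\mathcal R(\rho) : \pi_s(Q)\cap\pi_s(\tilde Q)\neq\emptyset\}.$$ **Proposition 1.** Let $d$ and $d'$ be the Hausdorff dimensions of $K$ and $K'$, and suppose that $d+d'<1$. Then for every $R>0$ there is a constant $C$ (independent of $\rho$) such that, for every $\rho\in(0,1)$, $N_\rho$ is finite-valued and integrable on $[-R,R]$, and $$\int_{-R}^{R}N_\rho(\lambda)\,d\lambda\le C\,\rho^{-d-d'}.$$ -/

import Mathlib

open Set MeasureTheory
open scoped NNReal ENNReal

noncomputable section

namespace RegularCantor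

/-! ### Subshifts of finite type -/

/-- The bilateral subshift of finite type `Σ ⊆ A^ℤ` with transition set `B`. -/
def subshift {A : Type*} (B : A → A → Prop) : Set (ℤ → A) :=
  {x | ∀ i : ℤ, B (x i) (x (i + 1))}

/-- The shift `σ` iterated `n` times, `(σⁿ x)ᵢ = xᵢ₊ₙ`. -/
def shift {A : Type*} (n : ℕ) (x : ℤ → A) : ℤ → A := fun i => x (i + n)

/-- The subshift is topologically mixing: `A` carries the discrete topology, `A^ℤ` the product
topology, and for any two relatively open non-empty subsets `U ∩ Σ`, `V ∩ Σ`, the set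
`σⁿ(U ∩ Σ) ∩ V` is non-empty for all large `n`. -/
def IsMixing {A : Type*} (B : A → A → Prop) : Prop :=
  letI : TopologicalSpace A := ⊥
  ∀ U V : Set (ℤ → A), IsOpen U → IsOpen V →
    (U ∩ subshift B).Nonempty → (V ∩ subshift B).Nonempty →
    ∃ N : ℕ, ∀ n ≥ N, ∃ x ∈ U ∩ subshift B, shift n x ∈ V

/-- Every letter of `A` occurs in some element of the subshift. -/
def UsesAllLetters {A : Type*} (B : A → A → Prop) : Prop :=
  ∀ a : A, ∃ x ∈ subshift B, ∃ i : ℤ, x i = a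

/-! ### Smoothness of real order -/

/-- `f` is of class `C^r` on `s`, for `r ∈ [0, ∞]`: smooth if `r = ∞`; otherwise `f` is `C^k` with
`k = ⌊r⌋` and its `k`-th derivative is Hölder of exponent `r - k` (when `r = k` the exponent is `0`,
and on a compact set the Hölder condition is void). -/
def IsCr (r : ℝ≥0∞) (f : ℝ → ℝ) (s : Set ℝ) : Prop :=
  if r = ⊤ then ContDiffOn ℝ ((⊤ : ℕ∞) : WithTop ℕ∞) f s
  else ContDiffOn ℝ (⌊r.toNNReal⌋₊ : WithTop ℕ∞) f s ∧
    ∃ C : ℝ≥0, HolderOnWith C (r.toNNReal - (⌊r.toNNReal⌋₊ : ℝ≥0))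
      (iteratedDerivWithin ⌊r.toNNReal⌋₊ f s) s

/-! ### Expanding maps and regular Cantor sets

The disjoint union of the lines `ℝ × {a}`, `a ∈ A`, is the sigma type `(_ : A) × ℝ`; the interval
`I(a)` is the copy of `[0,1]` over `a`. -/

/-- A `C^r` expanding map of type `Σ`, where `Σ` is given by the transition set `B`. The map `g` is
only relevant on its domain, the union of the intervals `I(a, b) = [lo a b, hi a b]` over `a`, with
`(a, b) ∈ B`. -/
structure ExpandingMap {A : Type*} (B : A → A → Prop) (r : ℝ≥0∞) where
  lo : A → A → ℝ
  hi : A → A → ℝ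
  g : (_ : A) × ℝ → (_ : A) × ℝ
  subset_unit : ∀ a b, B a b → Icc (lo a b) (hi a b) ⊆ Icc 0 1
  disjoint : ∀ a b c, B a b → B a c → b ≠ c →
    Disjoint (Icc (lo a b) (hi a b)) (Icc (lo a c) (hi a c))
  maps_fst : ∀ a b, B a b → ∀ t ∈ Icc (lo a b) (hi a b), (g ⟨a, t⟩).1 = b
  bijOn : ∀ a b, B a b → BijOn (fun t => (g ⟨a, t⟩).2) (Icc (lo a b) (hi a b)) (Icc 0 1)
  smooth : ∀ a b, B a b → IsCr r (fun t => (g ⟨a, t⟩).2) (Icc (lo a b) (hi a b))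
  expanding : ∀ a b, B a b → ∀ t ∈ Icc (lo a b) (hi a b),
    1 < |derivWithin (fun t => (g ⟨a, t⟩).2) (Icc (lo a b) (hi a b)) t|

namespace ExpandingMap

variable {A : Type*} {B : A → A → Prop} {r : ℝ≥0∞}

/-- The interval `I(a, b)`, as a subset of `[0,1]`. -/
def I₂ (G : ExpandingMap B r) (a b : A) : Set ℝ := Icc (G.lo a b) (G.hi a b)

/-- The domain of the expanding map. -/
def domain (G : ExpandingMap B r) : Set ((_ : A) × ℝ) :=
  {p | ∃ b, B p.1 b ∧ p.2 ∈ G.I₂ p.1 b}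

/-- The regular Cantor set `K = ⋂ₙ g⁻ⁿ(domain)`. -/
def K (G : ExpandingMap B r) : Set ((_ : A) × ℝ) :=
  ⋂ n : ℕ, G.g^[n] ⁻¹' G.domain

/-- The Hausdorff dimension of `K`. The disjoint union of the lines carries Mathlib's metric, which
is the usual distance on each line and is at least `1` between distinct lines. -/
def HD (G : ExpandingMap B r) : ℝ≥0∞ :=
  letI : MetricSpace ((_ : A) × ℝ) := Metric.Sigma.metricSpace
  dimH G.K

/-- The inverse branch `f_{(a,b)} : [0,1] → I(a, b)`. -/
def branch (G : ExpandingMap B r) (a b : A) : ℝ → ℝ :=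
  Function.invFunOn (fun t => (G.g ⟨a, t⟩).2) (G.I₂ a b)

/-- `f_{(a₀,…,aₙ)} = f_{(a₀,a₁)} ∘ ⋯ ∘ f_{(aₙ₋₁,aₙ)}`; the identity for a word of length one. -/
def wordMap (G : ExpandingMap B r) : List A → ℝ → ℝ
  | a :: b :: w => G.branch a b ∘ wordMap G (b :: w)
  | _ => id

/-- The interval `I(c)` of a word `c`, as a subset of `[0,1]`. -/
def wordInterval (G : ExpandingMap B r) (c : List A) : Set ℝ := G.wordMap c '' Icc 0 1

/-- The words `c` that begin by `a`, obey the transition rules, and satisfy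
`c₀⁻¹ ρ ≤ |I(c)| ≤ c₀ ρ`. -/
def words (G : ExpandingMap B r) (c₀ : ℝ) (a : A) (ρ : ℝ) : Set (List A) :=
  {c | c.IsChain B ∧ c.head? = some a ∧
    c₀⁻¹ * ρ ≤ Metric.diam (G.wordInterval c) ∧ Metric.diam (G.wordInterval c) ≤ c₀ * ρ}

end ExpandingMap

/-- `h` restricts to a `C¹` embedding of `[0,1]` into `ℝ`. -/
structure IsC1Embedding (h : ℝ → ℝ) : Prop where
  contDiffOn : ContDiffOn ℝ 1 h (Icc 0 1)
  injOn : InjOn h (Icc 0 1)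
  deriv_ne_zero : ∀ t ∈ Icc (0 : ℝ) 1, derivWithin h (Icc 0 1) t ≠ 0

/-- `π_s(x, y) = x - s y`. -/
def proj (s : ℝ) (p : ℝ × ℝ) : ℝ := p.1 - s * p.2

section Rectangles

variable {A A' : Type*} {B : A → A → Prop} {B' : A' → A' → Prop} {r r' : ℝ≥0∞}

/-- The rectangle `h(I(c)) × h'(I'(c'))` of a pair of words `(c, c')`. -/
def rect (G : ExpandingMap B r) (G' : ExpandingMap B' r') (h h' : ℝ → ℝ)
    (q : List A × List A') : Set (ℝ × ℝ) :=
  (h '' G.wordInterval q.1) ×ˢ (h' '' G'.wordInterval q.2)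

/-- The set of `ρ`-rectangles, indexed by pairs of words beginning by `a`, `a'`. -/
def rectangles (G : ExpandingMap B r) (G' : ExpandingMap B' r') (c₀ : ℝ) (a : A) (a' : A')
    (ρ : ℝ) : Set (List A × List A') :=
  G.words c₀ a ρ ×ˢ G'.words c₀ a' ρ

/-- The pairs of `ρ`-rectangles whose images by `π_s` intersect. -/
def overlaps (G : ExpandingMap B r) (G' : ExpandingMap B' r') (c₀ : ℝ) (a : A) (a' : A')
    (h h' : ℝ → ℝ) (ρ s : ℝ) : Set ((List A × List A') × (List A × List A')) :=
  {p | p.1 ∈ rectangles G G' c₀ a a' ρ ∧ p.2 ∈ rectangles G G' c₀ a a' ρ ∧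
    (proj s '' rect G G' h h' p.1 ∩ proj s '' rect G G' h h' p.2).Nonempty}

/-- `N_ρ(s)`, the number of pairs of `ρ`-rectangles whose images by `π_s` intersect. -/
def N (G : ExpandingMap B r) (G' : ExpandingMap B' r') (c₀ : ℝ) (a : A) (a' : A')
    (h h' : ℝ → ℝ) (ρ s : ℝ) : ℕ :=
  (overlaps G G' c₀ a a' h h' ρ s).ncard

end Rectangles

end RegularCantor

end

namespace RegularCantor

/-! ### One-variable calculus -/

theorem exists_sub_eq_derivWithin_mul {f : ℝ → ℝ} {lo hi : ℝ}
    (hf : DifferentiableOn ℝ f (Icc lo hi)) {u v : ℝ} (hu : u ∈ Icc lo hi) (hv : v ∈ Icc lo hi) :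
    ∃ ξ ∈ uIcc u v, f v - f u = derivWithin f (Icc lo hi) ξ * (v - u) := by
  wlog huv : u ≤ v generalizing u v
  · obtain ⟨ξ, hξ, h⟩ := this hv hu (le_of_not_ge huv)
    exact ⟨ξ, uIcc_comm u v ▸ hξ, by linarith⟩
  rcases huv.eq_or_lt with rfl | huv
  · exact ⟨u, by simp, by simp⟩
  have hsub : Icc u v ⊆ Icc lo hi := Icc_subset_Icc hu.1 hv.2
  obtain ⟨ξ, hξ, h⟩ := exists_hasDerivAt_eq_slope f (derivWithin f (Icc lo hi)) huv
    (hf.continuousOn.mono hsub) fun x hx => by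
      have hmem : Icc lo hi ∈ nhds x := Icc_mem_nhds (hu.1.trans_lt hx.1) (hx.2.trans_le hv.2)
      exact (hf x (hsub ⟨hx.1.le, hx.2.le⟩)).hasDerivWithinAt.hasDerivAt hmem
  refine ⟨ξ, by rw [uIcc_of_le huv.le]; exact ⟨hξ.1.le, hξ.2.le⟩, ?_⟩
  rw [h, div_mul_cancel₀ _ (sub_pos.2 huv).ne']

theorem uIcc_subset_of_mem {lo hi u v : ℝ} (hu : u ∈ Icc lo hi) (hv : v ∈ Icc lo hi) :
    uIcc u v ⊆ Icc lo hi :=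
  ordConnected_Icc.uIcc_subset hu hv

theorem exists_lipschitz_of_contDiffOn {f : ℝ → ℝ} {lo hi : ℝ} (hlt : lo < hi)
    (hf : ContDiffOn ℝ 1 f (Icc lo hi)) :
    ∃ L, 0 < L ∧ ∀ x ∈ Icc lo hi, ∀ y ∈ Icc lo hi, |f x - f y| ≤ L * |x - y| := by
  obtain ⟨C, hC⟩ := isCompact_Icc.exists_bound_of_continuousOn
    (hf.continuousOn_derivWithin (uniqueDiffOn_Icc hlt) le_rfl)
  refine ⟨max C 1, by positivity, fun x hx y hy => ?_⟩
  obtain ⟨ξ, hξ, h⟩ := exists_sub_eq_derivWithin_mul (hf.differentiableOn one_ne_zero) hy hx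
  rw [h, abs_mul]
  gcongr
  exact (hC ξ (uIcc_subset_of_mem hy hx hξ)).trans (le_max_left _ _)

theorem exists_antilipschitz_of_contDiffOn {f : ℝ → ℝ} {lo hi : ℝ} (hlt : lo < hi)
    (hf : ContDiffOn ℝ 1 f (Icc lo hi)) {t : ℝ}
    (h0 : ∀ x ∈ Icc lo hi, t < |derivWithin f (Icc lo hi) x|) :
    ∃ m, t < m ∧ ∀ x ∈ Icc lo hi, ∀ y ∈ Icc lo hi, m * |x - y| ≤ |f x - f y| := by
  obtain ⟨z, hz, hmin⟩ := isCompact_Icc.exists_isMinOn (nonempty_Icc.2 hlt.le)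
    (hf.continuousOn_derivWithin (uniqueDiffOn_Icc hlt) le_rfl).abs
  refine ⟨_, h0 z hz, fun x hx y hy => ?_⟩
  obtain ⟨ξ, hξ, h⟩ := exists_sub_eq_derivWithin_mul (hf.differentiableOn one_ne_zero) hy hx
  rw [h, abs_mul]
  exact mul_le_mul_of_nonneg_right (hmin (uIcc_subset_of_mem hy hx hξ)) (abs_nonneg _)

theorem contDiffOn_one_of_isCr {r : ℝ≥0∞} (hr : 1 < r) {f : ℝ → ℝ} {s : Set ℝ}
    (hf : IsCr r f s) : ContDiffOn ℝ 1 f s := by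
  unfold IsCr at hf
  split_ifs at hf with hr'
  · exact hf.of_le (by exact_mod_cast le_top)
  · refine hf.1.of_le ?_
    have : 1 ≤ ⌊r.toNNReal⌋₊ := by
      apply Nat.le_floor
      rw [← ENNReal.coe_le_coe, ENNReal.coe_toNNReal hr']
      simpa using hr.le
    exact_mod_cast this

theorem exists_holder_derivWithin_of_contDiffOn_two {f : ℝ → ℝ} {lo hi : ℝ} (hlt : lo < hi)
    (hf : ContDiffOn ℝ 2 f (Icc lo hi)) :
    ∃ H, ∀ x ∈ Icc lo hi, ∀ y ∈ Icc lo hi,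
      |derivWithin f (Icc lo hi) x - derivWithin f (Icc lo hi) y| ≤ H * |x - y| ^ (1 : ℝ) := by
  obtain ⟨L, -, h⟩ := exists_lipschitz_of_contDiffOn hlt
    (hf.derivWithin (uniqueDiffOn_Icc hlt) (m := 1) (by norm_num))
  exact ⟨L, by simpa using h⟩

theorem exists_holder_derivWithin_of_isCr {r : ℝ≥0∞} (hr : 1 < r) :
    ∃ α : ℝ, 0 < α ∧ ∀ (f : ℝ → ℝ) (lo hi : ℝ), lo < hi → IsCr r f (Icc lo hi) →
      ∃ H, ∀ x ∈ Icc lo hi, ∀ y ∈ Icc lo hi,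
        |derivWithin f (Icc lo hi) x - derivWithin f (Icc lo hi) y| ≤ H * |x - y| ^ α := by
  by_cases hr' : r = ⊤
  · refine ⟨1, one_pos, fun f lo hi hlt hf => ?_⟩
    rw [IsCr, if_pos hr'] at hf
    exact exists_holder_derivWithin_of_contDiffOn_two hlt
      (hf.of_le (WithTop.coe_le_coe.2 (le_top : (2 : ℕ∞) ≤ ⊤)))
  have h1 : 1 < r.toNNReal := by
    rw [← ENNReal.coe_lt_coe, ENNReal.coe_toNNReal hr']
    simpa using hr
  rcases (Nat.le_floor (by simpa using h1.le) : 1 ≤ ⌊r.toNNReal⌋₊).eq_or_lt with hk | hk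
  · refine ⟨(r.toNNReal - 1 : ℝ≥0), by simpa using h1, fun f lo hi hlt hf => ?_⟩
    rw [IsCr, if_neg hr', ← hk] at hf
    obtain ⟨-, C, hC⟩ := hf
    refine ⟨C, fun x hx y hy => ?_⟩
    have h := hC.dist_le hx hy
    simpa [Real.dist_eq, iteratedDerivWithin_one] using h
  · refine ⟨1, one_pos, fun f lo hi hlt hf => ?_⟩
    rw [IsCr, if_neg hr'] at hf
    exact exists_holder_derivWithin_of_contDiffOn_two hlt (hf.1.of_le (by exact_mod_cast hk))

theorem abs_sub_le_of_mem_uIcc {x y z w ξ η δ : ℝ} (hξ : ξ ∈ uIcc x y) (hη : η ∈ uIcc z w)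
    (hxz : |x - z| ≤ δ) (hxw : |x - w| ≤ δ) (hyz : |y - z| ≤ δ) (hyw : |y - w| ≤ δ) :
    |ξ - η| ≤ δ := by
  rw [mem_uIcc] at hξ hη
  rw [abs_le] at *
  rcases hξ with hξ | hξ <;> rcases hη with hη | hη <;> constructor <;> linarith

/-! ### Inverse branches -/

namespace ExpandingMap

variable {A : Type*} {B : A → A → Prop} {r : ℝ≥0∞} (G : ExpandingMap B r)

theorem lo_lt_hi {a b : A} (hab : B a b) : G.lo a b < G.hi a b := by
  by_contra! hle
  have hs : (Icc (G.lo a b) (G.hi a b)).Subsingleton := subsingleton_Icc_of_ge hle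
  have h := (G.bijOn a b hab).image_eq ▸ hs.image _
  exact zero_ne_one (h (by simp : (0 : ℝ) ∈ Icc 0 1) (by simp))

theorem branch_mem {a b : A} (hab : B a b) {x : ℝ} (hx : x ∈ Icc (0 : ℝ) 1) :
    G.branch a b x ∈ G.I₂ a b :=
  Function.invFunOn_mem ((G.bijOn a b hab).surjOn hx)

theorem branch_mem_unit {a b : A} (hab : B a b) {x : ℝ} (hx : x ∈ Icc (0 : ℝ) 1) :
    G.branch a b x ∈ Icc (0 : ℝ) 1 :=
  G.subset_unit a b hab (G.branch_mem hab hx)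

theorem g_branch {a b : A} (hab : B a b) {x : ℝ} (hx : x ∈ Icc (0 : ℝ) 1) :
    G.g ⟨a, G.branch a b x⟩ = ⟨b, x⟩ := by
  have h1 := G.maps_fst a b hab _ (G.branch_mem hab hx)
  have h2 : (G.g ⟨a, G.branch a b x⟩).2 = x :=
    Function.invFunOn_eq (f := fun t => (G.g ⟨a, t⟩).2) ((G.bijOn a b hab).surjOn hx)
  ext
  · exact h1
  · exact heq_of_eq h2

theorem g_branch_snd {a b : A} (hab : B a b) {x : ℝ} (hx : x ∈ Icc (0 : ℝ) 1) :
    (G.g ⟨a, G.branch a b x⟩).2 = x := by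
  rw [G.g_branch hab hx]

theorem exists_branch_contraction (hr : 1 < r) {a b : A} (hab : B a b) :
    ∃ θ, 0 < θ ∧ θ < 1 ∧ ∀ x ∈ Icc (0 : ℝ) 1, ∀ y ∈ Icc (0 : ℝ) 1,
      |G.branch a b x - G.branch a b y| ≤ θ * |x - y| := by
  obtain ⟨m, hm, h⟩ := exists_antilipschitz_of_contDiffOn (G.lo_lt_hi hab)
    (contDiffOn_one_of_isCr hr (G.smooth a b hab)) (G.expanding a b hab)
  refine ⟨m⁻¹, by positivity, inv_lt_one_of_one_lt₀ hm, fun x hx y hy => ?_⟩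
  have := h _ (G.branch_mem hab hx) _ (G.branch_mem hab hy)
  simp only [G.g_branch_snd hab hx, G.g_branch_snd hab hy] at this
  rwa [inv_mul_eq_div, le_div_iff₀' (by positivity)]

theorem branch_injOn {a b : A} (hab : B a b) : InjOn (G.branch a b) (Icc 0 1) :=
  fun x hx y hy h => by rw [← G.g_branch_snd hab hx, ← G.g_branch_snd hab hy, h]

/-- Distortion of a branch of Hölder exponent `α`. -/
theorem exists_branch_distortion (hr : 1 < r) {α : ℝ} (hα : 0 < α)
    (hH : ∀ (f : ℝ → ℝ) (lo hi : ℝ), lo < hi → IsCr r f (Icc lo hi) →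
      ∃ H, ∀ x ∈ Icc lo hi, ∀ y ∈ Icc lo hi,
        |derivWithin f (Icc lo hi) x - derivWithin f (Icc lo hi) y| ≤ H * |x - y| ^ α)
    {a b : A} (hab : B a b) :
    ∃ H, ∀ δ, ∀ s ⊆ Icc (0 : ℝ) 1, (∀ x ∈ s, ∀ y ∈ s, |x - y| ≤ δ) →
      ∀ x ∈ s, ∀ y ∈ s, ∀ z ∈ s, ∀ w ∈ s,
        |G.branch a b x - G.branch a b y| * |z - w| ≤
          Real.exp (H * δ ^ α) * (|G.branch a b z - G.branch a b w| * |x - y|) := by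
  obtain ⟨H₀, hH⟩ := hH _ _ _ (G.lo_lt_hi hab) (G.smooth a b hab)
  obtain ⟨θ, hθ0, hθ, hcontr⟩ := G.exists_branch_contraction hr hab
  refine ⟨max H₀ 0, fun δ s hs hδ x hx y hy z hz w hw => ?_⟩
  set φ := fun t => (G.g ⟨a, t⟩).2
  have hdiff := (contDiffOn_one_of_isCr hr (G.smooth a b hab)).differentiableOn one_ne_zero
  have hmem : ∀ {t}, t ∈ s → G.branch a b t ∈ Icc (G.lo a b) (G.hi a b) :=
    fun ht => G.branch_mem hab (hs ht)
  have hφ : ∀ {t}, t ∈ s → (G.g ⟨a, G.branch a b t⟩).2 = t := fun ht => G.g_branch_snd hab (hs ht)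
  have hd : ∀ {t u}, t ∈ s → u ∈ s → |G.branch a b t - G.branch a b u| ≤ δ := fun ht hu =>
    ((hcontr _ (hs ht) _ (hs hu)).trans (mul_le_of_le_one_left (abs_nonneg _) hθ.le)).trans
      (hδ _ ht _ hu)
  obtain ⟨ξ, hξ, h1⟩ := exists_sub_eq_derivWithin_mul hdiff (hmem hy) (hmem hx)
  obtain ⟨η, hη, h2⟩ := exists_sub_eq_derivWithin_mul hdiff (hmem hw) (hmem hz)
  have hξη := abs_sub_le_of_mem_uIcc hξ hη (hd hy hw) (hd hy hz) (hd hx hw) (hd hx hz)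
  have hξm := uIcc_subset_of_mem (hmem hy) (hmem hx) hξ
  have hηm := uIcc_subset_of_mem (hmem hw) (hmem hz) hη
  have hexp := G.expanding a b hab ξ hξm
  simp only [hφ hx, hφ hy, hφ hz, hφ hw] at h1 h2
  have hδ0 : 0 ≤ δ := (abs_nonneg _).trans hξη
  have hpow : |ξ - η| ^ α ≤ δ ^ α := Real.rpow_le_rpow (abs_nonneg _) hξη hα.le
  set P := derivWithin φ (Icc (G.lo a b) (G.hi a b)) ξ
  set Q := derivWithin φ (Icc (G.lo a b) (G.hi a b)) η
  have hPQ : |Q| ≤ Real.exp (max H₀ 0 * δ ^ α) * |P| := by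
    have e1 : |P - Q| ≤ max H₀ 0 * δ ^ α := (hH ξ hξm η hηm).trans (by
      gcongr
      exact le_max_left _ _)
    have e2 : max H₀ 0 * δ ^ α + 1 ≤ Real.exp (max H₀ 0 * δ ^ α) := Real.add_one_le_exp _
    have e3 : |Q| ≤ |P| + |P - Q| := by
      have := abs_sub_abs_le_abs_sub Q P
      rw [abs_sub_comm] at this
      linarith
    have e4 : 0 ≤ max H₀ 0 * δ ^ α := by positivity
    nlinarith
  rw [h1, h2, abs_mul, abs_mul]
  calc |G.branch a b x - G.branch a b y| * (|Q| * |G.branch a b z - G.branch a b w|)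
      = |Q| * (|G.branch a b x - G.branch a b y| * |G.branch a b z - G.branch a b w|) := by ring
    _ ≤ (Real.exp (max H₀ 0 * δ ^ α) * |P|) *
        (|G.branch a b x - G.branch a b y| * |G.branch a b z - G.branch a b w|) := by gcongr
    _ = _ := by ring

theorem exists_branch_separation {a b b' : A} (hab : B a b) (hab' : B a b') (hne : b ≠ b') :
    ∃ δ, 0 < δ ∧ ∀ x ∈ Icc (0 : ℝ) 1, ∀ y ∈ Icc (0 : ℝ) 1,
      δ ≤ |G.branch a b x - G.branch a b' y| := by
  obtain ⟨δ, hδ, h⟩ := Metric.exists_pos_forall_lt_edist isCompact_Icc isClosed_Icc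
    (G.disjoint a b b' hab hab' hne)
  refine ⟨δ, hδ, fun x hx y hy => ?_⟩
  have := h _ (G.branch_mem hab hx) _ (G.branch_mem hab' hy)
  rw [edist_nndist, ENNReal.coe_lt_coe] at this
  rw [← Real.dist_eq]
  exact_mod_cast this.le

end ExpandingMap

theorem exists_pos_le_of_finite {ι : Type*} [Finite ι] {f : ι → ℝ} (hf : ∀ i, 0 < f i) :
    ∃ ε, 0 < ε ∧ ε ≤ 1 ∧ ∀ i, ε ≤ f i := by
  obtain ⟨M, hM⟩ := (finite_range fun i => (f i)⁻¹).bddAbove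
  refine ⟨(max M 1)⁻¹, by positivity, inv_le_one_of_one_le₀ (le_max_right _ _), fun i => ?_⟩
  exact inv_le_of_inv_le₀ (hf i) ((hM (mem_range_self i)).trans (le_max_left _ _))

theorem exists_lt_one_of_finite {ι : Type*} [Finite ι] {f : ι → ℝ} (hf : ∀ i, f i < 1) :
    ∃ θ, 0 < θ ∧ θ < 1 ∧ ∀ i, f i ≤ θ := by
  obtain ⟨ε, h0, -, h⟩ := exists_pos_le_of_finite fun i => sub_pos.2 (hf i)
  refine ⟨max (1 - ε) (1 / 2), by positivity, max_lt (by linarith) (by norm_num), fun i => ?_⟩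
  exact le_max_of_le_left (by linarith [h i])

namespace ExpandingMap

variable {A : Type*} {B : A → A → Prop} {r : ℝ≥0∞} (G : ExpandingMap B r)

/-! ### Word maps -/

@[simp] theorem wordMap_nil : G.wordMap [] = id := rfl

@[simp] theorem wordMap_singleton (a : A) : G.wordMap [a] = id := rfl

theorem wordMap_cons_cons (a b : A) (w : List A) (x : ℝ) :
    G.wordMap (a :: b :: w) x = G.branch a b (G.wordMap (b :: w) x) := rfl

theorem wordMap_append (u : List A) (e : A) (v : List A) (x : ℝ) :
    G.wordMap (u ++ e :: v) x = G.wordMap (u ++ [e]) (G.wordMap (e :: v) x) := by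
  induction u with
  | nil => rfl
  | cons a u ih =>
    cases u with
    | nil => rfl
    | cons b u =>
      simp only [List.cons_append, wordMap_cons_cons] at ih ⊢
      rw [ih]

theorem wordMap_mem {c : List A} (hc : c.IsChain B) {x : ℝ} (hx : x ∈ Icc (0 : ℝ) 1) :
    G.wordMap c x ∈ Icc (0 : ℝ) 1 := by
  induction c using List.twoStepInduction with
  | nil => exact hx
  | singleton => exact hx
  | cons_cons a b w _ ih =>
    rw [List.isChain_cons_cons] at hc
    exact G.branch_mem_unit hc.1 (ih b hc.2)

theorem wordMap_injOn {c : List A} (hc : c.IsChain B) : InjOn (G.wordMap c) (Icc 0 1) := by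
  induction c using List.twoStepInduction with
  | nil => exact injOn_id _
  | singleton => exact injOn_id _
  | cons_cons a b w _ ih =>
    rw [List.isChain_cons_cons] at hc
    exact (G.branch_injOn hc.1).comp (ih b hc.2) fun _ hx => G.wordMap_mem hc.2 hx

/-- The distance between the images of the end points of `[0,1]` by `f_c`. -/
noncomputable def len (c : List A) : ℝ := |G.wordMap c 0 - G.wordMap c 1|

@[simp] theorem len_singleton (a : A) : G.len [a] = 1 := by simp [len]

theorem len_pos {c : List A} (hc : c.IsChain B) : 0 < G.len c := by
  refine abs_pos.2 (sub_ne_zero.2 fun h => ?_)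
  exact zero_ne_one (G.wordMap_injOn hc (by simp) (by simp) h)

theorem len_le_one {c : List A} (hc : c.IsChain B) : G.len c ≤ 1 := by
  have h0 := G.wordMap_mem hc (x := 0) (by simp)
  have h1 := G.wordMap_mem hc (x := 1) (by simp)
  rw [len, abs_le]
  constructor <;> linarith [h0.1, h0.2, h1.1, h1.2]

/-- Uniform estimates for the word maps: contraction rate `θ`, distortion `D`, separation `δ`. -/
structure Bounds (θ D δ : ℝ) : Prop where
  θ_pos : 0 < θ
  θ_lt_one : θ < 1
  one_le_D : 1 ≤ D
  δ_pos : 0 < δ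
  δ_le_one : δ ≤ 1
  contraction : ∀ c : List A, c.IsChain B → ∀ x ∈ Icc (0 : ℝ) 1, ∀ y ∈ Icc (0 : ℝ) 1,
    |G.wordMap c x - G.wordMap c y| ≤ θ ^ (c.length - 1) * |x - y|
  distortion : ∀ c : List A, c.IsChain B → ∀ x ∈ Icc (0 : ℝ) 1, ∀ y ∈ Icc (0 : ℝ) 1,
    ∀ z ∈ Icc (0 : ℝ) 1, ∀ w ∈ Icc (0 : ℝ) 1,
    |G.wordMap c x - G.wordMap c y| * |z - w| ≤ D * (|G.wordMap c z - G.wordMap c w| * |x - y|)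
  separation : ∀ a b b', B a b → B a b' → b ≠ b' → ∀ x ∈ Icc (0 : ℝ) 1, ∀ y ∈ Icc (0 : ℝ) 1,
    δ ≤ |G.branch a b x - G.branch a b' y|
  δ_le_len : ∀ a b, B a b → δ ≤ G.len [a, b]

theorem wordMap_contraction {θ : ℝ} (hθ : 0 < θ)
    (h : ∀ a b, B a b → ∀ x ∈ Icc (0 : ℝ) 1, ∀ y ∈ Icc (0 : ℝ) 1,
      |G.branch a b x - G.branch a b y| ≤ θ * |x - y|)
    {c : List A} (hc : c.IsChain B) {x y : ℝ} (hx : x ∈ Icc (0 : ℝ) 1) (hy : y ∈ Icc (0 : ℝ) 1) :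
    |G.wordMap c x - G.wordMap c y| ≤ θ ^ (c.length - 1) * |x - y| := by
  induction c using List.twoStepInduction with
  | nil => simp
  | singleton => simp
  | cons_cons a b w _ ih =>
    rw [List.isChain_cons_cons] at hc
    refine (h a b hc.1 _ (G.wordMap_mem hc.2 hx) _ (G.wordMap_mem hc.2 hy)).trans ?_
    have := mul_le_mul_of_nonneg_left (ih b hc.2) hθ.le
    simp only [List.length_cons, Nat.add_sub_cancel] at this ⊢
    rwa [pow_succ', mul_assoc]

theorem wordMap_distortion {θ H α : ℝ} (hθ : 0 < θ)
    (h : ∀ a b, B a b → ∀ x ∈ Icc (0 : ℝ) 1, ∀ y ∈ Icc (0 : ℝ) 1,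
      |G.branch a b x - G.branch a b y| ≤ θ * |x - y|)
    (hdist : ∀ a b, B a b → ∀ δ, 0 ≤ δ → ∀ s ⊆ Icc (0 : ℝ) 1, (∀ x ∈ s, ∀ y ∈ s, |x - y| ≤ δ) →
      ∀ x ∈ s, ∀ y ∈ s, ∀ z ∈ s, ∀ w ∈ s,
        |G.branch a b x - G.branch a b y| * |z - w| ≤
          Real.exp (H * δ ^ α) * (|G.branch a b z - G.branch a b w| * |x - y|))
    {c : List A} (hc : c.IsChain B) {x y z w : ℝ} (hx : x ∈ Icc (0 : ℝ) 1)
    (hy : y ∈ Icc (0 : ℝ) 1) (hz : z ∈ Icc (0 : ℝ) 1) (hw : w ∈ Icc (0 : ℝ) 1) :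
    |G.wordMap c x - G.wordMap c y| * |z - w| ≤
      Real.exp (H * ∑ j ∈ Finset.range (c.length - 1), (θ ^ α) ^ j) *
        (|G.wordMap c z - G.wordMap c w| * |x - y|) := by
  induction c using List.twoStepInduction with
  | nil => simp [mul_comm]
  | singleton => simp [mul_comm]
  | cons_cons a b v _ ih =>
    rw [List.isChain_cons_cons] at hc
    specialize ih b hc.2
    set F := G.wordMap (b :: v) with hF
    have hstep := hdist a b hc.1 (θ ^ v.length) (by positivity) (F '' Icc 0 1)
      (image_subset_iff.2 fun _ hx => G.wordMap_mem hc.2 hx) (by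
        rintro _ ⟨p, hp, rfl⟩ _ ⟨q, hq, rfl⟩
        refine (G.wordMap_contraction hθ h hc.2 hp hq).trans ?_
        refine mul_le_of_le_one_right (by positivity) (abs_le.2 ?_)
        constructor <;> linarith [hp.1, hp.2, hq.1, hq.2])
      _ (mem_image_of_mem F hx) _ (mem_image_of_mem F hy)
      _ (mem_image_of_mem F hz) _ (mem_image_of_mem F hw)
    simp only [wordMap_cons_cons, List.length_cons, Nat.add_sub_cancel, ← hF] at ih ⊢
    rw [Finset.sum_range_succ, mul_add, Real.exp_add]
    rw [← Real.rpow_natCast, ← Real.rpow_mul hθ.le, mul_comm (v.length : ℝ), Real.rpow_mul hθ.le,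
      Real.rpow_natCast] at hstep
    set E₁ := Real.exp (H * (θ ^ α) ^ v.length)
    set E₂ := Real.exp (H * ∑ j ∈ Finset.range v.length, (θ ^ α) ^ j)
    have hE₁ : 0 < E₁ := Real.exp_pos _
    rcases eq_or_ne z w with rfl | hzw
    · simp
    have hpos : 0 < |F z - F w| :=
      abs_pos.2 (sub_ne_zero.2 fun he => hzw (G.wordMap_injOn hc.2 hz hw he))
    refine le_of_mul_le_mul_right ?_ hpos
    calc |G.branch a b (F x) - G.branch a b (F y)| * |z - w| * |F z - F w|
        = (|G.branch a b (F x) - G.branch a b (F y)| * |F z - F w|) * |z - w| := by ring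
      _ ≤ (E₁ * (|G.branch a b (F z) - G.branch a b (F w)| * |F x - F y|)) * |z - w| := by gcongr
      _ = E₁ * |G.branch a b (F z) - G.branch a b (F w)| * (|F x - F y| * |z - w|) := by ring
      _ ≤ E₁ * |G.branch a b (F z) - G.branch a b (F w)| * (E₂ * (|F z - F w| * |x - y|)) := by
        gcongr
      _ = _ := by ring

theorem exists_bounds [Finite A] (hr : 1 < r) : ∃ θ D δ, G.Bounds θ D δ := by
  obtain ⟨α, hα, hH⟩ := exists_holder_derivWithin_of_isCr hr
  choose θ₁ hθ₁0 hθ₁ hcontr using fun p : {p : A × A // B p.1 p.2} =>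
    G.exists_branch_contraction hr p.2
  choose H₁ hH₁ using fun p : {p : A × A // B p.1 p.2} =>
    G.exists_branch_distortion hr hα hH p.2
  choose δ₁ hδ₁0 hδ₁ using
    fun p : {p : A × A × A // B p.1 p.2.1 ∧ B p.1 p.2.2 ∧ p.2.1 ≠ p.2.2} =>
      G.exists_branch_separation p.2.1 p.2.2.1 p.2.2.2
  obtain ⟨θ, hθ0, hθ, hθle⟩ := exists_lt_one_of_finite hθ₁
  obtain ⟨H₂, hH₂⟩ := (finite_range H₁).bddAbove
  obtain ⟨δ₂, hδ₂0, hδ₂1, hδ₂⟩ := exists_pos_le_of_finite hδ₁0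
  obtain ⟨δ₃, hδ₃0, hδ₃1, hδ₃⟩ := exists_pos_le_of_finite
    fun p : {p : A × A // B p.1 p.2} => G.len_pos (c := [p.1.1, p.1.2]) (by simpa using p.2)
  set H := max H₂ 0
  have hc : ∀ a b, B a b → ∀ x ∈ Icc (0 : ℝ) 1, ∀ y ∈ Icc (0 : ℝ) 1,
      |G.branch a b x - G.branch a b y| ≤ θ * |x - y| := fun a b hab x hx y hy =>
    (hcontr ⟨(a, b), hab⟩ x hx y hy).trans (by gcongr; exact hθle _)
  have hq0 : 0 < θ ^ α := Real.rpow_pos_of_pos hθ0 _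
  have hq1 : θ ^ α < 1 := Real.rpow_lt_one hθ0.le hθ hα
  refine ⟨θ, Real.exp (H * (1 - θ ^ α)⁻¹), min δ₂ δ₃, hθ0, hθ, ?_, lt_min hδ₂0 hδ₃0,
    (min_le_left _ _).trans hδ₂1, fun c hch x hx y hy => G.wordMap_contraction hθ0 hc hch hx hy,
    fun c hch x hx y hy z hz w hw => ?_, fun a b b' hab hab' hne x hx y hy =>
      (min_le_left _ _).trans ((hδ₂ ⟨(a, b, b'), hab, hab', hne⟩).trans (hδ₁ _ x hx y hy)),
    fun a b hab => (min_le_right _ _).trans (hδ₃ ⟨(a, b), hab⟩)⟩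
  · refine Real.one_le_exp (mul_nonneg (le_max_right _ _) ?_)
    exact inv_nonneg.2 (by linarith)
  · refine (G.wordMap_distortion (H := H) (α := α) hθ0 hc ?_ hch hx hy hz
      hw).trans ?_
    · intro a b hab δ hδ s hs hsδ x hx y hy z hz w hw
      refine (hH₁ ⟨(a, b), hab⟩ δ s hs hsδ x hx y hy z hz w hw).trans ?_
      gcongr
      exact (hH₂ (mem_range_self _)).trans (le_max_left _ _)
    · gcongr
      rw [← tsum_geometric_of_lt_one hq0.le hq1]
      exact (summable_geometric_of_lt_one hq0.le hq1).sum_le_tsum _ fun _ _ => by positivity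

end ExpandingMap

/-! ### A lower bound for the dimension of limit sets -/

/-- The composition `f_{ω 0} ∘ ⋯ ∘ f_{ω (n - 1)}`. -/
def ifsComp {ι : Type*} (f : ι → ℝ → ℝ) (ω : ℕ → ι) : ℕ → ℝ → ℝ
  | 0 => id
  | n + 1 => ifsComp f ω n ∘ f (ω n)

/-- The limit set of a family of maps of `[0,1]`. -/
def ifsLimit {ι : Type*} (f : ι → ℝ → ℝ) : Set ℝ :=
  {x | ∃ ω, ∀ n, x ∈ ifsComp f ω n '' Icc 0 1}

section IFS

variable {ι : Type*} {f : ι → ℝ → ℝ}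

theorem ifsComp_congr {ω ω' : ℕ → ι} {n : ℕ} (h : ∀ i < n, ω i = ω' i) :
    ifsComp f ω n = ifsComp f ω' n := by
  induction n with
  | zero => rfl
  | succ n ih =>
    rw [ifsComp, ifsComp, ih fun i hi => h i (hi.trans n.lt_succ_self), h n n.lt_succ_self]

theorem exists_forall_mem_ifsComp_image (hcont : ∀ i, ContinuousOn (f i) (Icc 0 1))
    (hmaps : ∀ i, MapsTo (f i) (Icc 0 1) (Icc 0 1)) (ω : ℕ → ι) :
    ∃ x, ∀ n, x ∈ ifsComp f ω n '' Icc 0 1 := by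
  have hc : ∀ n, ContinuousOn (ifsComp f ω n) (Icc 0 1) := by
    intro n
    induction n with
    | zero => exact continuousOn_id
    | succ n ih => exact ih.comp (hcont _) (hmaps _)
  have hK : ∀ n, IsCompact (ifsComp f ω n '' Icc 0 1) := fun n =>
    isCompact_Icc.image_of_continuousOn (hc n)
  obtain ⟨x, hx⟩ := IsCompact.nonempty_iInter_of_sequence_nonempty_isCompact_isClosed
    (fun n => ifsComp f ω n '' Icc 0 1) (fun n => by
      rw [ifsComp, image_comp]
      exact image_mono (hmaps _).image_subset)
    (fun n => (nonempty_Icc.2 zero_le_one).image _) (hK 0) fun n => (hK n).isClosed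
  exact ⟨x, mem_iInter.1 hx⟩

theorem pow_mul_le_ifsComp_sub (hmaps : ∀ i, MapsTo (f i) (Icc 0 1) (Icc 0 1)) {q : ℝ}
    (hq : 0 < q)
    (hexp : ∀ i, ∀ x ∈ Icc (0 : ℝ) 1, ∀ y ∈ Icc (0 : ℝ) 1, q * |x - y| ≤ |f i x - f i y|)
    (ω : ℕ → ι) (n : ℕ) {x y : ℝ} (hx : x ∈ Icc (0 : ℝ) 1) (hy : y ∈ Icc (0 : ℝ) 1) :
    q ^ n * |x - y| ≤ |ifsComp f ω n x - ifsComp f ω n y| := by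
  induction n generalizing x y with
  | zero => simp [ifsComp]
  | succ n ih =>
    refine le_trans ?_ (ih (hmaps (ω n) hx) (hmaps (ω n) hy))
    rw [pow_succ, mul_assoc]
    gcongr
    exact hexp _ x hx y hy

theorem ofReal_le_dimH_ifsLimit {m : ℕ} (hm : 1 < m) {f : Fin m → ℝ → ℝ}
    (hcont : ∀ i, ContinuousOn (f i) (Icc 0 1)) (hmaps : ∀ i, MapsTo (f i) (Icc 0 1) (Icc 0 1))
    {q : ℝ} (hq : 0 < q) (hq1 : q < 1)
    (hexp : ∀ i, ∀ x ∈ Icc (0 : ℝ) 1, ∀ y ∈ Icc (0 : ℝ) 1, q * |x - y| ≤ |f i x - f i y|)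
    {δ : ℝ} (hδ : 0 < δ)
    (hsep : ∀ i j, i ≠ j → ∀ x ∈ Icc (0 : ℝ) 1, ∀ y ∈ Icc (0 : ℝ) 1, δ ≤ |f i x - f j y|) :
    ENNReal.ofReal (Real.log m / Real.log q⁻¹) ≤ dimH (ifsLimit f) := by
  have hm0 : (0 : ℝ) < m := by positivity
  have : NeZero m := ⟨by omega⟩
  set s := Real.log m / Real.log q⁻¹ with hs
  have hlogq : 0 < Real.log q⁻¹ := Real.log_pos (one_lt_inv_iff₀.2 ⟨hq, hq1⟩)
  have hs0 : 0 < s := div_pos (Real.log_pos (by exact_mod_cast hm)) hlogq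
  have hqs : q ^ s = (m : ℝ)⁻¹ := by
    rw [Real.rpow_def_of_pos hq, hs, Real.log_inv, div_neg, mul_neg, mul_div_cancel₀,
      Real.exp_neg, Real.exp_log hm0]
    rw [Real.log_inv] at hlogq
    linarith
  choose x hx using exists_forall_mem_ifsComp_image hcont hmaps
  have key : ∀ ω ω', |Real.ofDigits ω - Real.ofDigits ω'| ≤ (δ⁻¹) ^ s * |x ω - x ω'| ^ s ∧
      (ω ≠ ω' → x ω ≠ x ω') := by
    intro ω ω'
    rcases eq_or_ne ω ω' with rfl | hne
    · refine ⟨?_, fun h => (h rfl).elim⟩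
      rw [sub_self, abs_zero]
      positivity
    have hex : ∃ n, ω n ≠ ω' n := Function.ne_iff.1 hne
    set n := Nat.find hex
    have hn : ω n ≠ ω' n := Nat.find_spec hex
    have hlt : ∀ i < n, ω i = ω' i := fun i hi => not_not.1 (Nat.find_min hex hi)
    have hlow : q ^ n * δ ≤ |x ω - x ω'| := by
      obtain ⟨y, hy, hy'⟩ := hx ω (n + 1)
      obtain ⟨z, hz, hz'⟩ := hx ω' (n + 1)
      rw [← hy', ← hz', ifsComp, ifsComp, ← ifsComp_congr hlt]
      refine le_trans ?_ (pow_mul_le_ifsComp_sub hmaps hq hexp ω n (hmaps _ hy) (hmaps _ hz))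
      gcongr
      exact hsep _ _ hn y hy z hz
    have hpos : 0 < |x ω - x ω'| := lt_of_lt_of_le (by positivity) hlow
    refine ⟨(Real.abs_ofDigits_sub_ofDigits_le hlt).trans ?_, fun _ h => by simp [h] at hpos⟩
    rw [← Real.mul_rpow (by positivity) (by positivity), ← inv_pow, ← hqs, ← Real.rpow_natCast,
      ← Real.rpow_mul hq.le, mul_comm s, Real.rpow_mul hq.le, Real.rpow_natCast]
    refine Real.rpow_le_rpow (by positivity) ?_ hs0.le
    rw [inv_mul_eq_div, le_div_iff₀ hδ]
    exact hlow
  have hinj : Function.Injective x := fun ω ω' h => not_not.1 fun hne => (key ω ω').2 hne h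
  set Φ : ℝ → ℝ := fun t => Real.ofDigits (Function.invFun x t)
  have hΦ : ∀ ω, Φ (x ω) = Real.ofDigits ω := fun ω => by
    simp only [Φ, Function.leftInverse_invFun hinj ω]
  have hholder : HolderOnWith ((δ⁻¹) ^ s).toNNReal s.toNNReal Φ (range x) := by
    rintro _ ⟨ω, rfl⟩ _ ⟨ω', rfl⟩
    rw [hΦ, hΦ, edist_dist, edist_dist, Real.dist_eq, Real.dist_eq, Real.coe_toNNReal _ hs0.le,
      ENNReal.ofReal_rpow_of_nonneg (abs_nonneg _) hs0.le]
    change _ ≤ ENNReal.ofReal _ * _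
    rw [← ENNReal.ofReal_mul (by positivity)]
    exact ENNReal.ofReal_le_ofReal (key ω ω').1
  have hsub : Icc (0 : ℝ) 1 ⊆ Φ '' range x := fun t ht => by
    obtain ⟨ω, -, rfl⟩ := Real.ofDigits_SurjOn hm ht
    exact ⟨x ω, mem_range_self _, hΦ ω⟩
  have h1 : dimH (Icc (0 : ℝ) 1) = 1 := by
    rw [Real.dimH_of_nonempty_interior (by simp)]
    simp
  have h2 := hholder.dimH_image_le (by simpa using hs0)
  have h3 : (1 : ℝ≥0∞) ≤ dimH (ifsLimit f) / ENNReal.ofReal s := by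
    rw [← h1]
    refine (dimH_mono hsub).trans (h2.trans ?_)
    refine ENNReal.div_le_div_right (dimH_mono ?_) _
    rintro _ ⟨ω, rfl⟩
    exact ⟨ω, hx ω⟩
  rw [ENNReal.le_div_iff_mul_le (by simp [hs0]) (by simp), one_mul] at h3
  exact h3

end IFS

namespace ExpandingMap

variable {A : Type*} {B : A → A → Prop} {r : ℝ≥0∞} (G : ExpandingMap B r)

theorem iterate_g_mem_domain {b : A} {w : List A} (hc : (b :: w).IsChain B) {x : ℝ}
    (hx : x ∈ Icc (0 : ℝ) 1) {n : ℕ} (hn : n < w.length) :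
    G.g^[n] ⟨b, G.wordMap (b :: w) x⟩ ∈ G.domain := by
  induction n generalizing b w with
  | zero =>
    cases w with
    | nil => simp at hn
    | cons e w =>
      rw [List.isChain_cons_cons] at hc
      exact ⟨e, hc.1, G.branch_mem hc.1 (G.wordMap_mem hc.2 hx)⟩
  | succ n ih =>
    cases w with
    | nil => simp at hn
    | cons e w =>
      rw [List.isChain_cons_cons] at hc
      rw [Function.iterate_succ_apply, wordMap_cons_cons,
        G.g_branch hc.1 (G.wordMap_mem hc.2 hx)]
      exact ih hc.2 (by simpa using hn)

namespace Bounds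

variable {G} {θ D δ : ℝ} (hG : G.Bounds θ D δ)
include hG

theorem D_pos : 0 < D := zero_lt_one.trans_le hG.one_le_D

theorem abs_sub_le {c : List A} (hc : c.IsChain B) {x y : ℝ} (hx : x ∈ Icc (0 : ℝ) 1)
    (hy : y ∈ Icc (0 : ℝ) 1) : |G.wordMap c x - G.wordMap c y| ≤ D * (G.len c * |x - y|) := by
  simpa [len] using hG.distortion c hc x hx y hy 0 (by simp) 1 (by simp)

theorem len_mul_le {c : List A} (hc : c.IsChain B) {x y : ℝ} (hx : x ∈ Icc (0 : ℝ) 1)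
    (hy : y ∈ Icc (0 : ℝ) 1) : G.len c * |x - y| ≤ D * |G.wordMap c x - G.wordMap c y| := by
  simpa [len] using hG.distortion c hc 0 (by simp) 1 (by simp) x hx y hy

theorem len_append_le {u v : List A} {e : A} (hc : (u ++ e :: v).IsChain B) :
    G.len (u ++ e :: v) ≤ D * (G.len (u ++ [e]) * G.len (e :: v)) := by
  rw [List.isChain_split] at hc
  have h := hG.abs_sub_le hc.1 (G.wordMap_mem hc.2 (x := 0) (by simp))
    (G.wordMap_mem hc.2 (x := 1) (by simp))
  rwa [← wordMap_append, ← wordMap_append] at h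

theorem len_mul_len_le {u v : List A} {e : A} (hc : (u ++ e :: v).IsChain B) :
    G.len (u ++ [e]) * G.len (e :: v) ≤ D * G.len (u ++ e :: v) := by
  rw [List.isChain_split] at hc
  have h := hG.len_mul_le hc.1 (G.wordMap_mem hc.2 (x := 0) (by simp))
    (G.wordMap_mem hc.2 (x := 1) (by simp))
  rwa [← wordMap_append, ← wordMap_append] at h

theorem len_le_pow {c : List A} (hc : c.IsChain B) : G.len c ≤ θ ^ (c.length - 1) := by
  simpa [len] using hG.contraction c hc 0 (by simp) 1 (by simp)

theorem continuousOn_wordMap {c : List A} (hc : c.IsChain B) :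
    ContinuousOn (G.wordMap c) (Icc 0 1) := by
  refine (LipschitzOnWith.of_dist_le_mul (K := 1) fun x hx y hy => ?_).continuousOn
  have := hG.contraction c hc x hx y hy
  rw [Real.dist_eq, Real.dist_eq, NNReal.coe_one]
  refine this.trans ?_
  gcongr
  exact pow_le_one₀ hG.θ_pos.le hG.θ_lt_one.le

end Bounds

end ExpandingMap

theorem exists_split_of_not_prefix {A : Type*} {a : A} {c c' : List A}
    (h : ¬ a :: c <+: a :: c') (h' : ¬ a :: c' <+: a :: c) :
    ∃ u e b b' v v', b ≠ b' ∧ a :: c = u ++ e :: b :: v ∧ a :: c' = u ++ e :: b' :: v' := by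
  induction c generalizing a c' with
  | nil => simp at h
  | cons b c ih =>
    cases c' with
    | nil => simp at h'
    | cons b' c' =>
      rcases eq_or_ne b b' with rfl | hne
      · obtain ⟨u, e, b₁, b₂, v, v', hne, h1, h2⟩ := ih (a := b) (c' := c')
          (fun hp => h (List.cons_prefix_cons.2 ⟨rfl, hp⟩))
          (fun hp => h' (List.cons_prefix_cons.2 ⟨rfl, hp⟩))
        exact ⟨a :: u, e, b₁, b₂, v, v', hne, by simp [h1], by simp [h2]⟩
      · exact ⟨[], a, b, b', c, c', hne, rfl, rfl⟩

namespace ExpandingMap.Bounds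

variable {A : Type*} {B : A → A → Prop} {r : ℝ≥0∞} {G : ExpandingMap B r}
  {θ D δ : ℝ} (hG : G.Bounds θ D δ)
include hG

/-- Points in the intervals of two incomparable words are far apart. -/
theorem len_le_dist_of_not_prefix {a : A} {c c' : List A} (hc : (a :: c).IsChain B)
    (hc' : (a :: c').IsChain B) (h : ¬ a :: c <+: a :: c') (h' : ¬ a :: c' <+: a :: c) {x y : ℝ}
    (hx : x ∈ Icc (0 : ℝ) 1) (hy : y ∈ Icc (0 : ℝ) 1) :
    δ * G.len (a :: c) ≤ D ^ 2 * |G.wordMap (a :: c) x - G.wordMap (a :: c') y| := by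
  obtain ⟨u, e, b, b', v, v', hne, h1, h2⟩ := exists_split_of_not_prefix h h'
  rw [h1] at hc ⊢
  rw [h2] at hc' ⊢
  have hlen := hG.len_append_le hc
  rw [List.isChain_split] at hc hc'
  have hl1 := G.len_le_one hc.2
  have hl0 := (G.len_pos hc.1).le
  have hm := G.wordMap_mem hc.2 hx
  have hm' := G.wordMap_mem hc'.2 hy
  have hd := hG.len_mul_le hc.1 hm hm'
  rw [G.wordMap_append u e (b :: v), G.wordMap_append u e (b' :: v')]
  have hc2 := List.isChain_cons_cons.1 hc.2
  have hc2' := List.isChain_cons_cons.1 hc'.2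
  have hsep := hG.separation e b b' hc2.1 hc2'.1 hne _ (G.wordMap_mem hc2.2 hx) _
    (G.wordMap_mem hc2'.2 hy)
  rw [← wordMap_cons_cons, ← wordMap_cons_cons] at hsep
  have hD := hG.D_pos
  have hδ := hG.δ_pos
  calc δ * G.len (u ++ e :: b :: v)
      ≤ δ * (D * (G.len (u ++ [e]) * 1)) := by
        gcongr
        exact hlen.trans (by gcongr)
    _ = D * (G.len (u ++ [e]) * δ) := by ring
    _ ≤ D * (D * |G.wordMap (u ++ [e]) (G.wordMap (e :: b :: v) x) -
        G.wordMap (u ++ [e]) (G.wordMap (e :: b' :: v') y)|) := by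
        exact mul_le_mul_of_nonneg_left ((mul_le_mul_of_nonneg_left hsep hl0).trans hd) hD.le
    _ = _ := by ring

/-- A family of incomparable loops of size at least `η` has at most `(2D/η)^d` elements. -/
theorem card_loops_le (hHD : G.HD ≠ ⊤) {b : A} {η : ℝ} (hη : 0 < η) (hη1 : η ≤ 1)
    {ι : Type*} (S : Finset ι) (t : ι → List A)
    (hS : ∀ i ∈ S, (b :: (t i ++ [b])).IsChain B ∧ η ≤ G.len (b :: (t i ++ [b])))
    (hinc : ∀ i ∈ S, ∀ j ∈ S, i ≠ j → ¬ b :: (t i ++ [b]) <+: b :: (t j ++ [b])) :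
    (S.card : ℝ) ≤ (2 * D / η) ^ G.HD.toReal := by
  have hD := hG.one_le_D
  have hbase : 1 < 2 * D / η := by
    rw [one_lt_div hη]
    linarith
  rcases le_or_gt S.card 1 with hcard | hcard
  · calc (S.card : ℝ) ≤ 1 := by exact_mod_cast hcard
      _ ≤ _ := Real.one_le_rpow hbase.le ENNReal.toReal_nonneg
  set q := (2 * D / η)⁻¹ with hq
  have hq0 : 0 < q := by positivity
  have hq1 : q < 1 := inv_lt_one_of_one_lt₀ hbase
  let e := S.equivFin.symm
  let c : Fin S.card → List A := fun i => b :: (t (e i) ++ [b])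
  have hc : ∀ i, (c i).IsChain B := fun i => (hS _ (e i).2).1
  have hlen : ∀ i, η ≤ G.len (c i) := fun i => (hS _ (e i).2).2
  have hc_inc : ∀ i j, i ≠ j → ¬ c i <+: c j := fun i j hij =>
    hinc _ (e i).2 _ (e j).2 fun h => hij (e.injective (Subtype.ext h))
  have hdim : ENNReal.ofReal (Real.log S.card / Real.log q⁻¹) ≤
      dimH (ifsLimit fun i => G.wordMap (c i)) := by
    refine ofReal_le_dimH_ifsLimit (δ := δ * η / D ^ 2) hcard
      (fun i => hG.continuousOn_wordMap (hc i)) (fun i x hx => G.wordMap_mem (hc i) hx) hq0 hq1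
      (fun i x hx y hy => ?_) (by have := hG.δ_pos; positivity) (fun i j hij x hx y hy => ?_)
    · have h1 := hG.len_mul_le (hc i) hx hy
      have h2 : η * |x - y| ≤ D * |G.wordMap (c i) x - G.wordMap (c i) y| :=
        le_trans (by gcongr; exact hlen i) h1
      rw [hq, inv_div, div_mul_eq_mul_div, div_le_iff₀ (by positivity)]
      nlinarith [abs_nonneg (G.wordMap (c i) x - G.wordMap (c i) y)]
    · rw [div_le_iff₀' (by positivity)]
      refine le_trans ?_ (hG.len_le_dist_of_not_prefix (hc i) (hc j) (hc_inc i j hij)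
        (hc_inc j i hij.symm) hx hy)
      exact mul_le_mul_of_nonneg_left (hlen i) hG.δ_pos.le
  have hsub : Sigma.mk b '' ifsLimit (fun i => G.wordMap (c i)) ⊆ G.K := by
    rintro _ ⟨x, ⟨ω, hω⟩, rfl⟩
    have hword : ∀ n, ∃ w : List A, n ≤ w.length ∧ (w ++ [b]).IsChain B ∧
        (w ++ [b]).head? = some b ∧ ifsComp (fun i => G.wordMap (c i)) ω n = G.wordMap (w ++ [b]) := by
      intro n
      induction n with
      | zero => exact ⟨[], by simp, by simp, by simp, rfl⟩
      | succ n ih =>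
        obtain ⟨w, hw, hch, hhead, heq⟩ := ih
        refine ⟨w ++ b :: t (e (ω n)), by simp; omega, ?_, ?_, ?_⟩
        · simpa using List.isChain_split.2 ⟨hch, hc (ω n)⟩
        · cases w <;> simp_all
        · ext y
          rw [ifsComp, heq, List.append_assoc, List.cons_append, wordMap_append]
          rfl
    refine mem_iInter.2 fun n => ?_
    obtain ⟨w, hw, hch, hhead, heq⟩ := hword (n + 1)
    obtain ⟨y, hy, hy'⟩ := hω (n + 1)
    rw [heq] at hy'
    rw [mem_preimage, ← hy']
    cases w with
    | nil => simp at hw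
    | cons b₀ w =>
      obtain rfl : b₀ = b := by simpa using hhead
      exact G.iterate_g_mem_domain hch hy (by simpa using hw)
  have hHDle : ENNReal.ofReal (Real.log S.card / Real.log q⁻¹) ≤ G.HD := by
    refine hdim.trans ?_
    let : MetricSpace ((_ : A) × ℝ) := Metric.Sigma.metricSpace
    rw [← (Metric.Sigma.isometry_mk (E := fun _ : A => ℝ) b).dimH_image]
    exact dimH_mono hsub
  have hle := (ENNReal.ofReal_le_iff_le_toReal hHD).1 hHDle
  have hlogq : 0 < Real.log q⁻¹ := Real.log_pos (one_lt_inv_iff₀.2 ⟨hq0, hq1⟩)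
  rw [div_le_iff₀ hlogq, hq, inv_inv] at hle
  rw [Real.le_rpow_iff_log_le (by positivity) (by positivity)]
  exact hle

end ExpandingMap.Bounds

theorem exists_connector {A : Type*} {B : A → A → Prop} (hmix : IsMixing B)
    (hall : UsesAllLetters B) (e b : A) : ∃ l : List A, (e :: (l ++ [b])).IsChain B := by
  have hne : ∀ a : A, ({x : ℤ → A | x 0 = a} ∩ subshift B).Nonempty := fun a => by
    obtain ⟨x, hx, i, hi⟩ := hall a
    refine ⟨fun j => x (j + i), by simpa using hi, fun j => ?_⟩
    have := hx (j + i)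
    rwa [add_right_comm] at this
  have hisOpen : ∀ a : A, letI : TopologicalSpace A := ⊥; IsOpen {x : ℤ → A | x 0 = a} := fun a => by
    let : TopologicalSpace A := ⊥
    have : DiscreteTopology A := ⟨rfl⟩
    exact (isOpen_discrete ({a} : Set A)).preimage
      (continuous_apply (A := fun _ : ℤ => A) (0 : ℤ))
  obtain ⟨N, hN⟩ := hmix _ _ (hisOpen e) (hisOpen b) (hne e) (hne b)
  obtain ⟨x, ⟨hx0, hx⟩, hxb⟩ := hN (N + 1) (Nat.le_succ N)
  have hchain : ∀ n : ℕ, ∃ l : List A, (x 0 :: (l ++ [x (n + 1)])).IsChain B := by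
    intro n
    induction n with
    | zero => exact ⟨[], by simpa using hx 0⟩
    | succ n ih =>
      obtain ⟨l, hl⟩ := ih
      refine ⟨l ++ [x (n + 1)], ?_⟩
      have h2 := hx (n + 1)
      have := List.isChain_append_cons_cons (R := B) (l₁ := x 0 :: l) (b := x (n + 1))
        (c := x (n + 1 + 1)) (l₂ := [])
      simpa using this.2 ⟨by simpa using hl, h2, by simp⟩
  obtain ⟨l, hl⟩ := hchain N
  refine ⟨l, ?_⟩
  rw [hx0] at hl
  have hb : x (N + 1) = b := by simpa [shift] using hxb
  rwa [hb] at hl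

theorem card_le_of_separated {ι : Type*} {S : Finset ι} {x : ι → ℝ} {T σ : ℝ} (hσ : 0 < σ)
    (hT : 0 ≤ T) (h : ∀ i ∈ S, ∀ j ∈ S, |x i - x j| ≤ T)
    (hsep : ∀ i ∈ S, ∀ j ∈ S, i ≠ j → σ ≤ |x i - x j|) : (S.card : ℝ) ≤ T / σ + 1 := by
  rcases S.eq_empty_or_nonempty with rfl | hS
  · simp
    positivity
  obtain ⟨k, hk, hmin⟩ := S.exists_min_image x hS
  have hle : S.card ≤ (Finset.range (⌊T / σ⌋₊ + 1)).card := by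
    refine Finset.card_le_card_of_injOn (fun i => ⌊(x i - x k) / σ⌋₊) (fun i hi => ?_)
      fun i hi j hj hij => ?_
    · simp only [Finset.coe_range, mem_Iio, Nat.lt_succ_iff]
      have := (le_abs_self _).trans (h i hi k hk)
      gcongr
    · by_contra hne
      have h1 : 0 ≤ (x i - x k) / σ := div_nonneg (sub_nonneg.2 (hmin i hi)) hσ.le
      have h2 : 0 ≤ (x j - x k) / σ := div_nonneg (sub_nonneg.2 (hmin j hj)) hσ.le
      have h3 := Nat.floor_le h1
      have h4 := Nat.floor_le h2
      have h5 := Nat.lt_floor_add_one ((x i - x k) / σ)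
      have h6 := Nat.lt_floor_add_one ((x j - x k) / σ)
      simp only at hij
      rw [hij] at h3 h5
      have h7 : |(x i - x k) / σ - (x j - x k) / σ| < 1 := by
        rw [abs_lt]
        constructor <;> linarith
      rw [← sub_div, sub_sub_sub_cancel_right, abs_div, abs_of_pos hσ, div_lt_one hσ] at h7
      exact absurd (hsep i hi j hj hne) (not_le.2 h7)
  rw [Finset.card_range] at hle
  calc (S.card : ℝ) ≤ ⌊T / σ⌋₊ + 1 := by exact_mod_cast hle
    _ ≤ T / σ + 1 := by
      gcongr
      exact Nat.floor_le (by positivity)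

namespace ExpandingMap

variable {A : Type*} {B : A → A → Prop} {r : ℝ≥0∞} (G : ExpandingMap B r)

/-- The words at which the size drops to at most `t` for the first time. -/
def stoppingWords (t : ℝ) : Set (List A) :=
  {p | p ≠ [] ∧ p.IsChain B ∧ G.len p ≤ t ∧ ∀ q, q <+: p → q ≠ p → q ≠ [] → t < G.len q}

theorem exists_stoppingWords_prefix {t : ℝ} {c : List A} (hne : c ≠ []) (hc : c.IsChain B)
    (hlen : G.len c ≤ t) : ∃ p ∈ G.stoppingWords t, p <+: c := by
  induction hn : c.length using Nat.strong_induction_on generalizing c with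
  | _ n ih =>
    by_cases hmin : ∀ q, q <+: c → q ≠ c → q ≠ [] → t < G.len q
    · exact ⟨c, ⟨hne, hc, hlen, hmin⟩, List.prefix_rfl⟩
    · push Not at hmin
      obtain ⟨q, hqc, hqne, hq0, hq⟩ := hmin
      have hlt : q.length < n := hn ▸ lt_of_le_of_ne hqc.length_le
        fun h => hqne (hqc.eq_of_length h)
      obtain ⟨p, hp, hpq⟩ := ih _ hlt hq0 (hc.prefix hqc) hq rfl
      exact ⟨p, hp, hpq.trans hqc⟩

variable {G}

theorem eq_of_prefix_of_mem_stoppingWords {t : ℝ} {p p' : List A} (hp : p ∈ G.stoppingWords t)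
    (hp' : p' ∈ G.stoppingWords t) (h : p <+: p') : p = p' := by
  by_contra hne
  exact absurd hp.2.2.1 (not_le.2 (hp'.2.2.2 p h hne hp.1))

theorem eq_of_prefix_common {t : ℝ} {p p' c : List A} (hp : p ∈ G.stoppingWords t)
    (hp' : p' ∈ G.stoppingWords t) (h : p <+: c) (h' : p' <+: c) : p = p' := by
  rcases List.prefix_or_prefix_of_prefix h h' with h | h
  · exact eq_of_prefix_of_mem_stoppingWords hp hp' h
  · exact (eq_of_prefix_of_mem_stoppingWords hp' hp h).symm

namespace Bounds

variable {θ D δ : ℝ} (hG : G.Bounds θ D δ)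
include hG

theorem len_stoppingWords {t : ℝ} (ht : 0 < t) (ht1 : t ≤ 1) {p : List A}
    (hp : p ∈ G.stoppingWords t) : δ * t ≤ D * G.len p := by
  obtain ⟨hne, hc, -, hprop⟩ := hp
  have hδ := hG.δ_pos
  rcases List.eq_nil_or_concat' p with rfl | ⟨q, e, rfl⟩
  · exact absurd rfl hne
  rcases List.eq_nil_or_concat' q with rfl | ⟨u, e', rfl⟩
  · simp only [List.nil_append, len_singleton, mul_one]
    exact (mul_le_one₀ hG.δ_le_one ht.le ht1).trans hG.one_le_D
  · have h1 := hprop (u ++ [e']) (List.prefix_append _ _) (by simp) (by simp)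
    rw [List.append_assoc, List.singleton_append] at hc ⊢
    have h2 := hG.len_mul_len_le hc
    have h3 := hG.δ_le_len e' e (by simpa using (List.isChain_split.1 hc).2)
    refine le_trans ?_ h2
    rw [mul_comm]
    exact mul_le_mul h1.le h3 hδ.le (ht.le.trans h1.le)

theorem finite_le_len [Finite A] {η : ℝ} (hη : 0 < η) :
    {c : List A | c.IsChain B ∧ η ≤ G.len c}.Finite := by
  obtain ⟨n, hn⟩ := exists_pow_lt_of_lt_one hη hG.θ_lt_one
  refine (List.finite_length_le A n).subset fun c hc => ?_
  by_contra! hlt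
  have hlt : n < c.length := by simpa using hlt
  have h1 := hc.2.trans (hG.len_le_pow hc.1)
  have h2 := pow_le_pow_of_le_one hG.θ_pos.le hG.θ_lt_one.le (show n ≤ c.length - 1 by omega)
  linarith

theorem finite_stoppingWords [Finite A] {t : ℝ} (ht : 0 < t) (ht1 : t ≤ 1) :
    (G.stoppingWords t).Finite := by
  have hδ := hG.δ_pos
  have hD := hG.D_pos
  refine (hG.finite_le_len (η := δ * t / D) (by positivity)).subset fun p hp => ⟨hp.2.1, ?_⟩
  rw [div_le_iff₀' hD]
  exact hG.len_stoppingWords ht ht1 hp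

theorem ncard_stoppingWords_head_le [Finite A] (hmix : IsMixing B) (hall : UsesAllLetters B)
    (hHD : G.HD ≠ ⊤) (b : A) : ∃ C, 0 ≤ C ∧ ∀ t, 0 < t → t ≤ 1 →
      ({p ∈ G.stoppingWords t | p.head? = some b}.ncard : ℝ) ≤ C * t ^ (-G.HD.toReal) := by
  choose l hl using fun e => exists_connector hmix hall e b
  obtain ⟨ε, hε0, hε1, hε⟩ := exists_pos_le_of_finite fun e => G.len_pos (hl e)
  have hδ := hG.δ_pos
  have hδ1 := hG.δ_le_one
  have hD := hG.D_pos
  have hD1 := hG.one_le_D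
  refine ⟨(2 * D ^ 3 / (δ * ε)) ^ G.HD.toReal, by positivity, fun t ht ht1 => ?_⟩
  have hfin := (hG.finite_stoppingWords ht ht1).subset
    (sep_subset (G.stoppingWords t) fun p => p.head? = some b)
  set η := δ * t * ε / D ^ 2 with hη
  have hη1 : η ≤ 1 := by
    rw [hη, div_le_one (by positivity)]
    exact (mul_le_one₀ (mul_le_one₀ hδ1 ht.le ht1) hε0.le hε1).trans (one_le_pow₀ hD1)
  have hword : ∀ p ∈ {p ∈ G.stoppingWords t | p.head? = some b}, ∃ w,
      p <+: b :: (w ++ [b]) ∧ (b :: (w ++ [b])).IsChain B ∧ η ≤ G.len (b :: (w ++ [b])) := by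
    rintro p ⟨hp, hhead⟩
    have hlen := hG.len_stoppingWords ht ht1 hp
    obtain ⟨hne, hc, -, -⟩ := hp
    obtain ⟨u, e, rfl⟩ := (List.eq_nil_or_concat' p).resolve_left hne
    obtain ⟨w, hw⟩ : ∃ w, u ++ e :: (l e ++ [b]) = b :: (w ++ [b]) := by
      cases u with
      | nil =>
        obtain rfl : e = b := by simpa using hhead
        exact ⟨l e, rfl⟩
      | cons b₀ u =>
        obtain rfl : b₀ = b := by simpa using hhead
        exact ⟨u ++ e :: l e, by simp⟩
    have hchain := List.isChain_split.2 ⟨hc, hl e⟩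
    refine ⟨w, hw ▸ ?_, hw ▸ hchain, hw ▸ ?_⟩
    · exact ⟨l e ++ [b], by simp⟩
    · have h1 := hG.len_mul_len_le hchain
      rw [hη, div_le_iff₀ (by positivity)]
      have h2 := (G.len_pos hc).le
      calc δ * t * ε ≤ D * G.len (u ++ [e]) * G.len (e :: (l e ++ [b])) := by
            gcongr
            exact hε e
        _ = D * (G.len (u ++ [e]) * G.len (e :: (l e ++ [b]))) := by ring
        _ ≤ D * (D * G.len (u ++ e :: (l e ++ [b]))) := by gcongr
        _ = _ := by ring
  choose! w hw using hword
  have hmain := hG.card_loops_le hHD (b := b) (η := η) (by positivity) hη1 hfin.toFinset w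
    (fun p hp => (hw p (hfin.mem_toFinset.1 hp)).2) fun p hp p' hp' hne hpre => hne <|
      eq_of_prefix_common (hfin.mem_toFinset.1 hp).1 (hfin.mem_toFinset.1 hp').1
        ((hw p (hfin.mem_toFinset.1 hp)).1.trans hpre) (hw p' (hfin.mem_toFinset.1 hp')).1
  rw [ncard_eq_toFinset_card _ hfin]
  refine hmain.trans (le_of_eq ?_)
  rw [Real.rpow_neg ht.le, ← Real.inv_rpow ht.le, ← Real.mul_rpow (by positivity) (by positivity)]
  congr 1
  rw [hη]
  field_simp

theorem ncard_stoppingWords_le [Finite A] (hmix : IsMixing B) (hall : UsesAllLetters B)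
    (hHD : G.HD ≠ ⊤) : ∃ C, 0 ≤ C ∧ ∀ t, 0 < t → t ≤ 1 →
      ((G.stoppingWords t).ncard : ℝ) ≤ C * t ^ (-G.HD.toReal) := by
  choose C hC0 hC using hG.ncard_stoppingWords_head_le hmix hall hHD
  cases nonempty_fintype A
  refine ⟨∑ b, C b, Finset.sum_nonneg fun b _ => hC0 b, fun t ht ht1 => ?_⟩
  have hsub : G.stoppingWords t ⊆ ⋃ b, {p ∈ G.stoppingWords t | p.head? = some b} := by
    intro p hp
    obtain ⟨b, hb⟩ : ∃ b, p.head? = some b := ⟨_, List.head?_eq_some_head hp.1⟩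
    exact mem_iUnion.2 ⟨b, hp, hb⟩
  have hfin : (⋃ b, {p ∈ G.stoppingWords t | p.head? = some b}).Finite :=
    finite_iUnion fun b => (hG.finite_stoppingWords ht ht1).subset (sep_subset _ _)
  rw [Finset.sum_mul]
  calc ((G.stoppingWords t).ncard : ℝ)
      ≤ ∑ b, ({p ∈ G.stoppingWords t | p.head? = some b}.ncard : ℝ) := by
        exact_mod_cast (ncard_le_ncard hsub hfin).trans
          (by simpa using Finset.univ.set_ncard_biUnion_le _)
    _ ≤ _ := Finset.sum_le_sum fun b _ => hC b t ht ht1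

/-- Decomposition of a word at its stopping prefix. -/
theorem exists_decomposition {t : ℝ} (ht : 0 < t) (ht1 : t ≤ 1) {c : List A} (hne : c ≠ [])
    (hc : c.IsChain B) (hlen : G.len c ≤ t) :
    ∃ p ∈ G.stoppingWords t, ∃ v, v ≠ [] ∧ v.IsChain B ∧ c = p ++ v.tail ∧ p <+: c ∧
      (∀ x, G.wordMap c x = G.wordMap p (G.wordMap v x)) ∧
      G.len c ≤ D * t * G.len v ∧ δ * t * G.len v ≤ D ^ 2 * G.len c := by
  obtain ⟨p, hp, hpc⟩ := G.exists_stoppingWords_prefix hne hc hlen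
  obtain ⟨u, e, rfl⟩ := (List.eq_nil_or_concat' p).resolve_left hp.1
  obtain ⟨v, rfl⟩ := hpc
  refine ⟨_, hp, e :: v, by simp, ?_⟩
  have h1 := hG.len_stoppingWords ht ht1 hp
  rw [List.append_assoc, List.singleton_append] at hc ⊢
  have hc' := List.isChain_split.1 hc
  have hl := (G.len_pos hc'.2).le
  have hD := hG.D_pos
  refine ⟨hc'.2, by simp, ⟨v, by simp⟩, fun x => G.wordMap_append u e v x, ?_, ?_⟩
  · calc G.len (u ++ e :: v) ≤ D * (G.len (u ++ [e]) * G.len (e :: v)) := hG.len_append_le hc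
      _ ≤ D * (t * G.len (e :: v)) := by gcongr; exact hp.2.2.1
      _ = _ := by ring
  · calc δ * t * G.len (e :: v) ≤ D * G.len (u ++ [e]) * G.len (e :: v) := by gcongr
      _ = D * (G.len (u ++ [e]) * G.len (e :: v)) := by ring
      _ ≤ D * (D * G.len (u ++ e :: v)) :=
        mul_le_mul_of_nonneg_left (hG.len_mul_len_le hc) hD.le
      _ = _ := by ring

theorem ncard_words_le [Finite A] (hmix : IsMixing B) (hall : UsesAllLetters B)
    (hHD : G.HD ≠ ⊤) {κ : ℝ} (hκ : 1 ≤ κ) : ∃ C, 0 ≤ C ∧ ∀ η, 0 < η →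
      ({c : List A | c ≠ [] ∧ c.IsChain B ∧ η ≤ G.len c ∧ G.len c ≤ κ * η}.ncard : ℝ) ≤
        C * η ^ (-G.HD.toReal) := by
  obtain ⟨C, hC0, hC⟩ := hG.ncard_stoppingWords_le hmix hall hHD
  have hD := hG.D_pos
  have hF := hG.finite_le_len (η := (D * κ)⁻¹) (by positivity)
  set F := {c : List A | c.IsChain B ∧ (D * κ)⁻¹ ≤ G.len c}
  refine ⟨C * F.ncard, by positivity, fun η hη => ?_⟩
  rcases lt_or_ge 1 η with hη1 | hη1
  · rw [show {c : List A | c ≠ [] ∧ c.IsChain B ∧ η ≤ G.len c ∧ G.len c ≤ κ * η} = ∅ from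
      eq_empty_of_forall_notMem fun c hc => by
        linarith [G.len_le_one hc.2.1, hc.2.2.1]]
    simp only [ncard_empty, Nat.cast_zero]
    positivity
  set t := min (κ * η) 1
  have ht : 0 < t := lt_min (by positivity) one_pos
  have ht1 : t ≤ 1 := min_le_right _ _
  have htη : η ≤ t := le_min (le_mul_of_one_le_left hη.le hκ) hη1
  have hsub : {c : List A | c ≠ [] ∧ c.IsChain B ∧ η ≤ G.len c ∧ G.len c ≤ κ * η} ⊆
      (fun x : List A × List A => x.1 ++ x.2.tail) '' (G.stoppingWords t ×ˢ F) := by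
    rintro c ⟨hne, hc, hlo, hhi⟩
    obtain ⟨p, hp, v, -, hv, hcv, -, -, h1, -⟩ :=
      hG.exists_decomposition ht ht1 hne hc (le_min hhi (G.len_le_one hc))
    refine ⟨(p, v), ⟨hp, hv, ?_⟩, hcv.symm⟩
    have hl := (G.len_pos hv).le
    rw [inv_le_iff_one_le_mul₀' (by positivity)]
    have h2 : η ≤ D * (κ * η) * G.len v := (hlo.trans h1).trans (by
      gcongr
      exact min_le_left _ _)
    nlinarith
  have hfin := (hG.finite_stoppingWords ht ht1).prod hF
  calc _ ≤ ((G.stoppingWords t).ncard : ℝ) * F.ncard := by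
        exact_mod_cast ((ncard_le_ncard hsub (hfin.image _)).trans (ncard_image_le hfin)).trans_eq
          (ncard_prod)
    _ ≤ C * t ^ (-G.HD.toReal) * F.ncard := by gcongr; exact hC t ht ht1
    _ ≤ C * η ^ (-G.HD.toReal) * F.ncard := by
        have : t ^ (-G.HD.toReal) ≤ η ^ (-G.HD.toReal) :=
          Real.rpow_le_rpow_of_nonpos hη htη (by simp)
        gcongr
    _ = _ := by ring

/-- The number of words of size comparable to `η` whose base point is `τ`-close to `z`. -/
theorem ncard_words_near_le [Finite A] (hmix : IsMixing B) (hall : UsesAllLetters B)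
    (hHD : G.HD ≠ ⊤) {κ : ℝ} (hκ : 1 ≤ κ) (a : A) : ∃ C, 0 ≤ C ∧ ∀ η τ z, 0 < η → η ≤ τ →
      ({c : List A | c.head? = some a ∧ c.IsChain B ∧ η ≤ G.len c ∧ G.len c ≤ κ * η ∧
        |G.wordMap c 0 - z| ≤ τ}.ncard : ℝ) ≤ C * (τ / η) ^ G.HD.toReal := by
  have hD := hG.D_pos
  have hD1 := hG.one_le_D
  have hδ := hG.δ_pos
  have hδ1 := hG.δ_le_one
  obtain ⟨C, hC0, hC⟩ := hG.ncard_words_le hmix hall hHD (κ := D ^ 3 * κ / δ) (by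
    rw [one_le_div hδ]
    exact hδ1.trans (one_le_mul_of_one_le_of_one_le (one_le_pow₀ hD1) hκ))
  refine ⟨(2 * D ^ 3 / δ ^ 2 + 1) * (C * (D * κ) ^ G.HD.toReal), by positivity,
    fun η τ z hη hτ => ?_⟩
  have hτ0 : 0 < τ := hη.trans_le hτ
  set t := min (κ * τ) 1
  have ht : 0 < t := lt_min (by positivity) one_pos
  have ht1 : t ≤ 1 := min_le_right _ _
  set P := {p ∈ G.stoppingWords t | p.head? = some a ∧
    ∃ x ∈ Icc (0 : ℝ) 1, |G.wordMap p x - z| ≤ τ} with hP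
  have hPfin : P.Finite := (hG.finite_stoppingWords ht ht1).subset (sep_subset _ _)
  set η₂ := η / (D * t) with hη₂
  have hη₂0 : 0 < η₂ := by positivity
  set V := {c : List A | c ≠ [] ∧ c.IsChain B ∧ η₂ ≤ G.len c ∧
    G.len c ≤ D ^ 3 * κ / δ * η₂}
  have hVfin : V.Finite := (hG.finite_le_len hη₂0).subset fun c hc => ⟨hc.2.1, hc.2.2.1⟩
  have hsub : {c : List A | c.head? = some a ∧ c.IsChain B ∧ η ≤ G.len c ∧ G.len c ≤ κ * η ∧
        |G.wordMap c 0 - z| ≤ τ} ⊆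
      (fun x : List A × List A => x.1 ++ x.2.tail) '' (P ×ˢ V) := by
    rintro c ⟨hhead, hc, hlo, hhi, hz⟩
    have hne : c ≠ [] := by
      rintro rfl
      simp at hhead
    obtain ⟨p, hp, v, hv0, hv, hcv, hpc, hmap, h1, h2⟩ := hG.exists_decomposition ht ht1 hne hc
      (le_min (hhi.trans (by gcongr)) (G.len_le_one hc))
    refine ⟨(p, v), ⟨⟨hp, ?_, G.wordMap v 0, G.wordMap_mem hv (by simp), hmap 0 ▸ hz⟩,
      hv0, hv, ?_, ?_⟩, hcv.symm⟩
    · obtain ⟨w, rfl⟩ := hpc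
      cases p with
      | nil => exact absurd rfl hp.1
      | cons b p => simpa using hhead
    · rw [hη₂, div_le_iff₀' (by positivity)]
      exact hlo.trans h1
    · rw [hη₂]
      refine le_of_mul_le_mul_left ?_ (show 0 < δ * t by positivity)
      refine h2.trans ?_
      calc D ^ 2 * G.len c ≤ D ^ 2 * (κ * η) := by gcongr
        _ = _ := by field_simp
  have hPcard : (P.ncard : ℝ) ≤ 2 * D ^ 3 / δ ^ 2 + 1 := by
    choose! x hx hxz using fun p (hp : p ∈ P) => hp.2.2
    rw [ncard_eq_toFinset_card _ hPfin]
    have hsep := card_le_of_separated (S := hPfin.toFinset) (x := fun p => G.wordMap p (x p))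
      (T := 2 * t) (σ := δ ^ 2 * t / D ^ 3) (by positivity) (by positivity)
      (fun p hp p' hp' => ?_) (fun p hp p' hp' hne => ?_)
    · refine hsep.trans_eq ?_
      field_simp
    · rw [hPfin.mem_toFinset] at hp hp'
      have e1 := G.wordMap_mem hp.1.2.1 (hx p hp)
      have e2 := G.wordMap_mem hp'.1.2.1 (hx p' hp')
      have e3 := abs_le.1 (hxz p hp)
      have e4 := abs_le.1 (hxz p' hp')
      have e5 : τ ≤ κ * τ := le_mul_of_one_le_left hτ0.le hκ
      rw [abs_le]
      rcases min_cases (κ * τ) 1 with h | h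
      · constructor <;> linarith
      · constructor <;> linarith [e1.1, e1.2, e2.1, e2.2]
    · rw [hPfin.mem_toFinset] at hp hp'
      have hpp := fun h => hne (eq_of_prefix_of_mem_stoppingWords hp.1 hp'.1 h)
      have hpp' := fun h => hne.symm (eq_of_prefix_of_mem_stoppingWords hp'.1 hp.1 h)
      have hlen := hG.len_stoppingWords ht ht1 hp.1
      obtain ⟨u, rfl⟩ : ∃ u, p = a :: u := List.head?_eq_some_iff.1 hp.2.1
      obtain ⟨u', rfl⟩ : ∃ u, p' = a :: u := List.head?_eq_some_iff.1 hp'.2.1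
      have := hG.len_le_dist_of_not_prefix hp.1.2.1 hp'.1.2.1 hpp hpp' (hx _ hp) (hx _ hp')
      rw [div_le_iff₀' (by positivity)]
      calc δ ^ 2 * t = δ * (δ * t) := by ring
        _ ≤ δ * (D * G.len (a :: u)) := by gcongr
        _ = D * (δ * G.len (a :: u)) := by ring
        _ ≤ D * _ := mul_le_mul_of_nonneg_left this hD.le
        _ = _ := by ring
  have hfin := hPfin.prod hVfin
  calc _ ≤ (P.ncard : ℝ) * V.ncard := by
        exact_mod_cast ((ncard_le_ncard hsub (hfin.image _)).trans (ncard_image_le hfin)).trans_eq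
          (ncard_prod)
    _ ≤ (2 * D ^ 3 / δ ^ 2 + 1) * (C * η₂ ^ (-G.HD.toReal)) := by
        gcongr
        exact hC η₂ hη₂0
    _ ≤ (2 * D ^ 3 / δ ^ 2 + 1) * (C * ((D * κ) ^ G.HD.toReal * (τ / η) ^ G.HD.toReal)) := by
        have : η₂ ^ (-G.HD.toReal) ≤ (D * κ) ^ G.HD.toReal * (τ / η) ^ G.HD.toReal := by
          rw [Real.rpow_neg hη₂0.le, ← Real.inv_rpow hη₂0.le,
            ← Real.mul_rpow (by positivity) (by positivity)]
          refine Real.rpow_le_rpow (by positivity) ?_ ENNReal.toReal_nonneg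
          rw [hη₂, inv_div, ← mul_div_assoc, mul_assoc]
          gcongr
          exact min_le_left _ _
        gcongr
    _ = _ := by ring

end Bounds

end ExpandingMap

/-! ### The counting estimate -/

namespace ExpandingMap

variable {A : Type*} {B : A → A → Prop} {r : ℝ≥0∞} {G : ExpandingMap B r} {θ D δ : ℝ}

namespace Bounds

variable (hG : G.Bounds θ D δ)
include hG

theorem isCompact_wordInterval {c : List A} (hc : c.IsChain B) : IsCompact (G.wordInterval c) :=
  isCompact_Icc.image_of_continuousOn (hG.continuousOn_wordMap hc)

theorem len_le_diam {c : List A} (hc : c.IsChain B) : G.len c ≤ Metric.diam (G.wordInterval c) :=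
  Metric.dist_le_diam_of_mem (hG.isCompact_wordInterval hc).isBounded
    (mem_image_of_mem _ (by simp)) (mem_image_of_mem _ (by simp))

theorem diam_le_len {c : List A} (hc : c.IsChain B) :
    Metric.diam (G.wordInterval c) ≤ D * G.len c := by
  have hl := (G.len_pos hc).le
  have hD := hG.D_pos
  refine Metric.diam_le_of_forall_dist_le (by positivity) ?_
  rintro _ ⟨x, hx, rfl⟩ _ ⟨y, hy, rfl⟩
  refine (hG.abs_sub_le hc hx hy).trans ?_
  gcongr
  refine mul_le_of_le_one_right hl (abs_le.2 ?_)
  constructor <;> linarith [hx.1, hx.2, hy.1, hy.2]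

theorem finite_words [Finite A] {c₀ : ℝ} (hc₀ : 1 < c₀) (a : A) {ρ : ℝ} (hρ : 0 < ρ) :
    (G.words c₀ a ρ).Finite := by
  have hD := hG.D_pos
  refine (hG.finite_le_len (η := c₀⁻¹ * ρ / D) (by positivity)).subset fun c hc => ⟨hc.1, ?_⟩
  rw [div_le_iff₀' hD]
  exact hc.2.2.1.trans (hG.diam_le_len hc.1)

theorem exists_ncard_words_le [Finite A] (hmix : IsMixing B) (hall : UsesAllLetters B)
    (hHD : G.HD ≠ ⊤) {c₀ : ℝ} (hc₀ : 1 < c₀) (a : A) : ∃ C, 0 ≤ C ∧ ∀ ρ τ z, 0 < ρ → ρ ≤ τ →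
      ({c ∈ G.words c₀ a ρ | |G.wordMap c 0 - z| ≤ τ}.ncard : ℝ) ≤ C * (τ / ρ) ^ G.HD.toReal := by
  have hD := hG.D_pos
  have hD1 := hG.one_le_D
  obtain ⟨C, hC0, hC⟩ := hG.ncard_words_near_le hmix hall hHD (κ := c₀ ^ 2 * D)
    (one_le_mul_of_one_le_of_one_le (one_le_pow₀ hc₀.le) hD1) a
  refine ⟨C * (c₀ * D) ^ G.HD.toReal, by positivity, fun ρ τ z hρ hτ => ?_⟩
  have hη : 0 < ρ / (c₀ * D) := by positivity
  have hητ : ρ / (c₀ * D) ≤ τ :=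
    (div_le_self hρ.le (one_le_mul_of_one_le_of_one_le hc₀.le hD1)).trans hτ
  have hτ0 := hρ.trans_le hτ
  have hsub : {c ∈ G.words c₀ a ρ | |G.wordMap c 0 - z| ≤ τ} ⊆
      {c : List A | c.head? = some a ∧ c.IsChain B ∧ ρ / (c₀ * D) ≤ G.len c ∧
        G.len c ≤ c₀ ^ 2 * D * (ρ / (c₀ * D)) ∧ |G.wordMap c 0 - z| ≤ τ} := by
    rintro c ⟨⟨hch, hhead, hlo, hhi⟩, hz⟩
    refine ⟨hhead, hch, ?_, ?_, hz⟩
    · have := hlo.trans (hG.diam_le_len hch)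
      rw [inv_mul_le_iff₀ (by positivity)] at this
      rw [div_le_iff₀ (by positivity)]
      linarith
    · refine ((hG.len_le_diam hch).trans hhi).trans_eq ?_
      field_simp
  have hfin : {c : List A | c.head? = some a ∧ c.IsChain B ∧ ρ / (c₀ * D) ≤ G.len c ∧
      G.len c ≤ c₀ ^ 2 * D * (ρ / (c₀ * D)) ∧ |G.wordMap c 0 - z| ≤ τ}.Finite :=
    (hG.finite_le_len hη).subset fun c hc => ⟨hc.2.1, hc.2.2.1⟩
  calc _ ≤ C * (τ / (ρ / (c₀ * D))) ^ G.HD.toReal :=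
        (Nat.cast_le.2 (ncard_le_ncard hsub hfin)).trans (hC _ τ z hη hητ)
    _ = C * ((c₀ * D) ^ G.HD.toReal * (τ / ρ) ^ G.HD.toReal) := by
        rw [← Real.mul_rpow (by positivity) (by positivity)]
        congr 2
        field_simp
    _ = _ := by ring

/-- The counting estimates for the image of the Cantor set by a `C¹` embedding. -/
theorem exists_embedded_count [Finite A] (hmix : IsMixing B) (hall : UsesAllLetters B)
    (hHD : G.HD ≠ ⊤) {c₀ : ℝ} (hc₀ : 1 < c₀) (a : A) {h : ℝ → ℝ} (hh : IsC1Embedding h) :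
    ∃ C L, 0 ≤ C ∧ 0 < L ∧ ∀ ρ, 0 < ρ → ρ < 1 →
      ((G.words c₀ a ρ).ncard : ℝ) ≤ C * ρ ^ (-G.HD.toReal) ∧
      (∀ c ∈ G.words c₀ a ρ, ∀ τ, ρ ≤ τ →
        ({e ∈ G.words c₀ a ρ | |h (G.wordMap c 0) - h (G.wordMap e 0)| ≤ τ}.ncard : ℝ) ≤
          C * (τ / ρ) ^ G.HD.toReal) ∧
      ∀ c ∈ G.words c₀ a ρ, ∀ x ∈ h '' G.wordInterval c, |x - h (G.wordMap c 0)| ≤ L * ρ := by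
  obtain ⟨C, hC0, hC⟩ := hG.exists_ncard_words_le hmix hall hHD hc₀ a
  obtain ⟨L, hL0, hL⟩ := exists_lipschitz_of_contDiffOn one_pos hh.contDiffOn
  obtain ⟨m, hm0, hm⟩ := exists_antilipschitz_of_contDiffOn one_pos hh.contDiffOn
    fun x hx => abs_pos.2 (hh.deriv_ne_zero x hx)
  set M := max m⁻¹ 1
  have hM1 : 1 ≤ M := le_max_right _ _
  refine ⟨C * M ^ G.HD.toReal, L * c₀, by positivity, by positivity, fun ρ hρ hρ1 => ?_⟩
  refine ⟨?_, fun c hc τ hτ => ?_, ?_⟩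
  · have hone := hC ρ 1 0 hρ hρ1.le
    rw [sep_eq_self_iff_mem_true.2 fun c hc => ?_] at hone
    · rw [one_div, Real.inv_rpow hρ.le, ← Real.rpow_neg hρ.le] at hone
      refine hone.trans ?_
      gcongr
      exact le_mul_of_one_le_right hC0 (Real.one_le_rpow hM1 ENNReal.toReal_nonneg)
    · have := G.wordMap_mem hc.1 (x := 0) (by simp)
      rw [sub_zero, abs_of_nonneg this.1]
      exact this.2
  · have hτ0 := hρ.trans_le hτ
    have hcnt := hC ρ (M * τ) (G.wordMap c 0) hρ (hτ.trans (le_mul_of_one_le_left hτ0.le hM1))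
    rw [mul_div_assoc, Real.mul_rpow (by positivity) (by positivity), ← mul_assoc] at hcnt
    refine le_trans (Nat.cast_le.2 (ncard_le_ncard ?_ ?_)) hcnt
    · rintro e ⟨he, hle⟩
      refine ⟨he, ?_⟩
      have := (hm _ (G.wordMap_mem hc.1 (x := 0) (by simp)) _
        (G.wordMap_mem he.1 (x := 0) (by simp))).trans hle
      rw [abs_sub_comm]
      rw [← le_inv_mul_iff₀ hm0] at this
      exact this.trans (by gcongr; exact le_max_left _ _)
    · exact (hG.finite_words hc₀ a hρ).subset (sep_subset _ _)
  · rintro c hc _ ⟨_, ⟨x, hx, rfl⟩, rfl⟩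
    refine (hL _ (G.wordMap_mem hc.1 hx) _ (G.wordMap_mem hc.1 (x := 0) (by simp))).trans ?_
    rw [mul_assoc]
    gcongr
    exact (Metric.dist_le_diam_of_mem (hG.isCompact_wordInterval hc.1).isBounded
      (mem_image_of_mem _ hx) (mem_image_of_mem _ (by simp))).trans hc.2.2.2

end Bounds

end ExpandingMap

/-! ### Summation over pairs of points -/

theorem volume_real_slab_le {u v ρ E R : ℝ} (hρ : 0 < ρ) (hE : 0 < E) (hR : 0 < R) {n : ℕ}
    (hn : |v| ≤ 2 ^ n * ρ) :
    volume.real {s | s ∈ Icc (-R) R ∧ |u - s * v| ≤ E * ρ} ≤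
      ∑ k ∈ Finset.range (n + 1), if |u| ≤ (E + R) * 2 ^ k * ρ ∧ |v| ≤ 2 ^ k * ρ then
        (2 * R + 4 * E) * (1 / 2) ^ k else 0 := by
  have hnn : ∀ k ∈ Finset.range (n + 1), 0 ≤ if |u| ≤ (E + R) * 2 ^ k * ρ ∧ |v| ≤ 2 ^ k * ρ then
        (2 * R + 4 * E) * (1 / 2 : ℝ) ^ k else 0 := fun k _ => by
    split_ifs
    · positivity
    · exact le_rfl
  rcases eq_empty_or_nonempty {s | s ∈ Icc (-R) R ∧ |u - s * v| ≤ E * ρ} with hempty | ⟨s, hs, hsu⟩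
  · rw [hempty, measureReal_empty]
    exact Finset.sum_nonneg hnn
  have hu : |u| ≤ E * ρ + R * |v| := by
    have h1 : |u| ≤ |u - s * v| + |s * v| := by simpa using abs_add_le (u - s * v) (s * v)
    have h2 : |s * v| ≤ R * |v| := by
      rw [abs_mul]
      gcongr
      exact abs_le.2 hs
    linarith
  have hex : ∃ k : ℕ, |v| ≤ 2 ^ k * ρ := ⟨n, hn⟩
  set k := Nat.find hex
  have hk : |v| ≤ 2 ^ k * ρ := Nat.find_spec hex
  have hkn : k ≤ n := Nat.find_min' hex hn
  have hle := Finset.single_le_sum hnn (Finset.mem_range.2 (Nat.lt_succ_of_le hkn))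
  refine le_trans ?_ hle
  have h2k : (1 : ℝ) ≤ 2 ^ k := one_le_pow₀ one_le_two
  have huk : |u| ≤ (E + R) * 2 ^ k * ρ := by
    calc |u| ≤ E * ρ + R * |v| := hu
      _ ≤ E * (2 ^ k * ρ) + R * (2 ^ k * ρ) := by
        gcongr
        exact le_mul_of_one_le_left hρ.le h2k
      _ = _ := by ring
  rw [if_pos ⟨huk, hk⟩]
  rcases Nat.eq_zero_or_pos k with h0 | hpos
  · have hsub : {s | s ∈ Icc (-R) R ∧ |u - s * v| ≤ E * ρ} ⊆ Icc (-R) R := fun s hs => hs.1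
    refine (measureReal_mono hsub (by simp)).trans ?_
    rw [Real.volume_real_Icc_of_le (by linarith), h0]
    simp only [pow_zero, mul_one]
    linarith
  · obtain ⟨j, hj⟩ := Nat.exists_eq_succ_of_ne_zero hpos.ne'
    have hlt : 2 ^ j * ρ < |v| := by
      have := Nat.find_min hex (m := j) (show j < k by omega)
      exact not_le.1 this
    have hv : 0 < |v| := lt_trans (by positivity) hlt
    have hsub : {s | s ∈ Icc (-R) R ∧ |u - s * v| ≤ E * ρ} ⊆
        Metric.closedBall (u / v) (E * ρ / |v|) := by
      rintro s ⟨-, hs⟩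
      rw [Metric.mem_closedBall, Real.dist_eq, le_div_iff₀ hv, ← abs_mul, sub_mul,
        div_mul_cancel₀ _ (abs_pos.1 hv), abs_sub_comm]
      exact hs
    refine (measureReal_mono hsub measure_closedBall_lt_top.ne).trans ?_
    rw [Real.volume_real_closedBall (by positivity), hj]
    calc 2 * (E * ρ / |v|) ≤ 2 * (E * ρ / (2 ^ j * ρ)) := by gcongr
      _ = 4 * E * (1 / 2) ^ (j + 1) := by
        rw [pow_succ, one_div, inv_pow]
        field_simp
        norm_num
      _ ≤ _ := by
        gcongr
        linarith

theorem sum_volume_real_le {ι ι' : Type*} (S : Finset ι) (S' : Finset ι') (X : ι → ℝ) (Y : ι' → ℝ)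
    {ρ E R C C' d d' : ℝ} (hρ : 0 < ρ) (hE : 1 ≤ E) (hR : 0 < R) (hC : 0 ≤ C) (hC' : 0 ≤ C')
    (hd : d + d' < 1)
    (hX : ∀ i ∈ S, ∀ τ, ρ ≤ τ → ((S.filter fun j => |X i - X j| ≤ τ).card : ℝ) ≤ C * (τ / ρ) ^ d)
    (hY : ∀ i ∈ S', ∀ τ, ρ ≤ τ →
      ((S'.filter fun j => |Y i - Y j| ≤ τ).card : ℝ) ≤ C' * (τ / ρ) ^ d') :
    ∑ p ∈ (S ×ˢ S') ×ˢ (S ×ˢ S'), volume.real {s | s ∈ Icc (-R) R ∧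
        |(X p.1.1 - X p.2.1) - s * (Y p.1.2 - Y p.2.2)| ≤ E * ρ} ≤
      (2 * R + 4 * E) * C * C' * (E + R) ^ d * (1 - 2 ^ (d + d' - 1))⁻¹ * (S.card * S'.card) := by
  have hER : 1 ≤ E + R := by linarith
  have hE0 : 0 < E := by linarith
  obtain ⟨n, hn⟩ : ∃ n : ℕ, ∀ p ∈ S' ×ˢ S', |Y p.1 - Y p.2| ≤ 2 ^ n * ρ := by
    obtain ⟨M, hM⟩ := ((S' ×ˢ S').image fun p => |Y p.1 - Y p.2|).bddAbove
    obtain ⟨n, hn⟩ := pow_unbounded_of_one_lt (M / ρ) one_lt_two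
    refine ⟨n, fun p hp => (hM (Finset.mem_coe.2 (Finset.mem_image_of_mem _ hp))).trans ?_⟩
    rw [div_lt_iff₀ hρ] at hn
    exact hn.le
  set x : ℝ := 2 ^ (d + d' - 1)
  have hx0 : 0 < x := Real.rpow_pos_of_pos two_pos _
  have hx1 : x < 1 := Real.rpow_lt_one_of_one_lt_of_neg one_lt_two (by linarith)
  set M := (2 * R + 4 * E) * C * C' * (E + R) ^ d
  have hM : 0 ≤ M := by positivity
  have hinner : ∀ q ∈ S ×ˢ S', ∑ p ∈ S ×ˢ S', volume.real {s | s ∈ Icc (-R) R ∧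
      |(X q.1 - X p.1) - s * (Y q.2 - Y p.2)| ≤ E * ρ} ≤ M * (1 - x)⁻¹ := by
    intro q hq
    rw [Finset.mem_product] at hq
    calc ∑ p ∈ S ×ˢ S', volume.real {s | s ∈ Icc (-R) R ∧
          |(X q.1 - X p.1) - s * (Y q.2 - Y p.2)| ≤ E * ρ}
        ≤ ∑ p ∈ S ×ˢ S', ∑ k ∈ Finset.range (n + 1),
          if |X q.1 - X p.1| ≤ (E + R) * 2 ^ k * ρ ∧ |Y q.2 - Y p.2| ≤ 2 ^ k * ρ then
            (2 * R + 4 * E) * (1 / 2 : ℝ) ^ k else 0 := by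
          refine Finset.sum_le_sum fun p hp => volume_real_slab_le hρ hE0 hR ?_
          rw [Finset.mem_product] at hp
          exact hn (q.2, p.2) (Finset.mem_product.2 ⟨hq.2, hp.2⟩)
      _ = ∑ k ∈ Finset.range (n + 1),
          ((S.filter fun j => |X q.1 - X j| ≤ (E + R) * 2 ^ k * ρ).card *
            (S'.filter fun j => |Y q.2 - Y j| ≤ 2 ^ k * ρ).card) *
            ((2 * R + 4 * E) * (1 / 2 : ℝ) ^ k) := by
          rw [Finset.sum_comm]
          refine Finset.sum_congr rfl fun k _ => ?_
          rw [← Finset.sum_filter, Finset.sum_const,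
            Finset.filter_product (fun j => |X q.1 - X j| ≤ (E + R) * 2 ^ k * ρ)
              (fun j => |Y q.2 - Y j| ≤ 2 ^ k * ρ), Finset.card_product, nsmul_eq_mul,
            Nat.cast_mul]
      _ ≤ ∑ k ∈ Finset.range (n + 1), M * x ^ k := by
          refine Finset.sum_le_sum fun k _ => ?_
          have h2k : (1 : ℝ) ≤ 2 ^ k := one_le_pow₀ one_le_two
          have h1 := hX q.1 hq.1 ((E + R) * 2 ^ k * ρ) (le_mul_of_one_le_left hρ.le
            (one_le_mul_of_one_le_of_one_le hER h2k))
          have h2 := hY q.2 hq.2 (2 ^ k * ρ) (le_mul_of_one_le_left hρ.le h2k)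
          rw [mul_div_cancel_right₀ _ hρ.ne'] at h1 h2
          rw [Real.mul_rpow (by positivity) (by positivity)] at h1
          have hxk : x ^ k = ((2 : ℝ) ^ k) ^ d * ((2 : ℝ) ^ k) ^ d' * (1 / 2) ^ k := by
            rw [← Real.rpow_add (by positivity), ← Real.rpow_natCast, ← Real.rpow_natCast 2,
              ← Real.rpow_mul two_pos.le, ← Real.rpow_mul two_pos.le, one_div, inv_pow,
              ← Real.rpow_natCast, ← Real.rpow_neg two_pos.le, ← Real.rpow_add two_pos]
            congr 1
            ring
          calc _ ≤ (C * ((E + R) ^ d * ((2 : ℝ) ^ k) ^ d)) * (C' * ((2 : ℝ) ^ k) ^ d') *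
                ((2 * R + 4 * E) * (1 / 2 : ℝ) ^ k) := by gcongr
            _ = M * (((2 : ℝ) ^ k) ^ d * ((2 : ℝ) ^ k) ^ d' * (1 / 2) ^ k) := by
              simp only [M]
              ring
            _ = _ := by rw [hxk]
      _ ≤ M * (1 - x)⁻¹ := by
          rw [← Finset.mul_sum]
          gcongr
          rw [← tsum_geometric_of_lt_one hx0.le hx1]
          exact (summable_geometric_of_lt_one hx0.le hx1).sum_le_tsum _ fun _ _ => by positivity
  rw [Finset.sum_product]
  refine (Finset.sum_le_sum hinner).trans_eq ?_
  rw [Finset.sum_const, Finset.card_product, nsmul_eq_mul, Nat.cast_mul]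
  ring

theorem isClosed_setOf_proj_inter {P Q : Set (ℝ × ℝ)} (hP : IsCompact P) (hQ : IsCompact Q) :
    IsClosed {s | (proj s '' P ∩ proj s '' Q).Nonempty} := by
  have : CompactSpace ↥(P ×ˢ Q) := isCompact_iff_compactSpace.1 (hP.prod hQ)
  have hcl : IsClosed {z : ℝ × ↥(P ×ˢ Q) | proj z.1 z.2.1.1 = proj z.1 z.2.1.2} := by
    unfold proj
    exact isClosed_eq (by fun_prop) (by fun_prop)
  convert! isClosedMap_fst_of_compactSpace _ hcl
  ext s
  constructor
  · rintro ⟨_, ⟨x, hx, rfl⟩, y, hy, hxy⟩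
    exact ⟨(s, ⟨(x, y), hx, hy⟩), hxy.symm, rfl⟩
  · rintro ⟨⟨_, ⟨⟨x, y⟩, hx, hy⟩⟩, hxy, rfl⟩
    exact ⟨_, ⟨x, hx, rfl⟩, y, hy, hxy.symm⟩

theorem abs_sub_le_of_proj_inter {P Q : Set (ℝ × ℝ)} {x y : ℝ × ℝ} {s R ε ε' : ℝ}
    (hs : |s| ≤ R) (hP : ∀ p ∈ P, |p.1 - x.1| ≤ ε ∧ |p.2 - x.2| ≤ ε')
    (hQ : ∀ p ∈ Q, |p.1 - y.1| ≤ ε ∧ |p.2 - y.2| ≤ ε')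
    (h : (proj s '' P ∩ proj s '' Q).Nonempty) :
    |(x.1 - y.1) - s * (x.2 - y.2)| ≤ 2 * ε + 2 * R * ε' := by
  obtain ⟨_, ⟨p, hp, rfl⟩, q, hq, hpq⟩ := h
  obtain ⟨p1, p2⟩ := hP p hp
  obtain ⟨q1, q2⟩ := hQ q hq
  simp only [proj] at hpq
  have hmul : ∀ t, |t| ≤ ε' → |s * t| ≤ R * ε' := fun t ht => by
    rw [abs_mul]
    exact mul_le_mul hs ht (abs_nonneg _) ((abs_nonneg _).trans hs)
  have p3 := abs_le.1 (hmul _ p2)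
  have q3 := abs_le.1 (hmul _ q2)
  rw [abs_le] at p1 q1 ⊢
  constructor <;> linarith

theorem card_filter_toFinset {ι : Type*} {W : Set ι} (hW : W.Finite) (P : ι → Prop)
    [DecidablePred P] : (hW.toFinset.filter P).card = {e ∈ W | P e}.ncard := by
  rw [← ncard_coe_finset]
  congr 1
  ext e
  simp

end RegularCantor

open RegularCantor in
theorem proposition1 {A A' : Type*} [Finite A] [Finite A']
    (B : A → A → Prop) (B' : A' → A' → Prop)
    (hmix : RegularCantor.IsMixing B) (hmix' : RegularCantor.IsMixing B')
    (hall : RegularCantor.UsesAllLetters B) (hall' : RegularCantor.UsesAllLetters B')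
    (r r' : ℝ≥0∞) (hr : 1 < r) (hr' : 1 < r')
    (G : RegularCantor.ExpandingMap B r) (G' : RegularCantor.ExpandingMap B' r')
    (hdim : G.HD + G'.HD < 1)
    (a : A) (a' : A') (h h' : ℝ → ℝ)
    (hh : RegularCantor.IsC1Embedding h) (hh' : RegularCantor.IsC1Embedding h')
    (c₀ : ℝ) (hc₀ : 1 < c₀) (R : ℝ) (hR : 0 < R) :
    ∃ C : ℝ, ∀ ρ ∈ Set.Ioo (0 : ℝ) 1,
      (∀ s : ℝ, (RegularCantor.overlaps G G' c₀ a a' h h' ρ s).Finite) ∧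
      IntervalIntegrable
        (fun s => (RegularCantor.N G G' c₀ a a' h h' ρ s : ℝ)) MeasureTheory.volume (-R) R ∧
      ∫ s in (-R)..R, (RegularCantor.N G G' c₀ a a' h h' ρ s : ℝ)
        ≤ C * ρ ^ (-G.HD.toReal - G'.HD.toReal) := by
  classical
  obtain ⟨θ, D, δ, hG⟩ := G.exists_bounds hr
  obtain ⟨θ', D', δ', hG'⟩ := G'.exists_bounds hr'
  have hHD : G.HD ≠ ⊤ := ne_top_of_lt (le_self_add.trans_lt hdim)
  have hHD' : G'.HD ≠ ⊤ := ne_top_of_lt (le_add_self.trans_lt hdim)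
  have hdim' : G.HD.toReal + G'.HD.toReal < 1 := by
    rw [← ENNReal.toReal_add hHD hHD', ← ENNReal.toReal_one]
    exact (ENNReal.toReal_lt_toReal (ENNReal.add_ne_top.2 ⟨hHD, hHD'⟩) ENNReal.one_ne_top).2 hdim
  obtain ⟨C, L, hC0, hL0, hC⟩ := hG.exists_embedded_count hmix hall hHD hc₀ a hh
  obtain ⟨C', L', hC0', hL0', hC'⟩ := hG'.exists_embedded_count hmix' hall' hHD' hc₀ a' hh'
  set E := max (2 * L + 2 * R * L') 1
  have hE : 1 ≤ E := le_max_right _ _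
  set M := (2 * R + 4 * E) * C * C' * (E + R) ^ G.HD.toReal *
    (1 - 2 ^ (G.HD.toReal + G'.HD.toReal - 1))⁻¹
  have hM : 0 ≤ M := by
    have : (2 : ℝ) ^ (G.HD.toReal + G'.HD.toReal - 1) ≤ 1 :=
      Real.rpow_le_one_of_one_le_of_nonpos one_le_two (by linarith)
    have : 0 ≤ (1 - (2 : ℝ) ^ (G.HD.toReal + G'.HD.toReal - 1))⁻¹ :=
      inv_nonneg.2 (by linarith)
    positivity
  refine ⟨M * (C * C'), fun ρ ⟨hρ, hρ1⟩ => ?_⟩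
  obtain ⟨hcard, hnear, hball⟩ := hC ρ hρ hρ1
  obtain ⟨hcard', hnear', hball'⟩ := hC' ρ hρ hρ1
  have hS := hG.finite_words hc₀ a hρ
  have hS' := hG'.finite_words hc₀ a' hρ
  set S := hS.toFinset
  set S' := hS'.toFinset
  have hmem : ∀ q, q ∈ rectangles G G' c₀ a a' ρ ↔ q ∈ S ×ˢ S' := fun q => by
    simp only [rectangles, mem_prod, Finset.mem_product, S, S', Finite.mem_toFinset]
  let Z : (List A × List A') × (List A × List A') → Set ℝ := fun p =>
    {s | (proj s '' rect G G' h h' p.1 ∩ proj s '' rect G G' h h' p.2).Nonempty}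
  have hover : ∀ s, overlaps G G' c₀ a a' h h' ρ s =
      ↑(((S ×ˢ S') ×ˢ (S ×ˢ S')).filter fun p => s ∈ Z p) := fun s => by
    ext p
    simp only [overlaps, mem_ofPred_eq, Finset.coe_filter, Finset.mem_product (s := S ×ˢ S'), hmem,
      and_assoc, Z]
  have hN : ∀ s, (N G G' c₀ a a' h h' ρ s : ℝ) =
      ∑ p ∈ (S ×ˢ S') ×ˢ (S ×ˢ S'), (Z p).indicator 1 s := fun s => by
    rw [N, hover, ncard_coe_finset, Finset.card_filter, Nat.cast_sum]
    refine Finset.sum_congr rfl fun p _ => ?_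
    simp [indicator_apply]
  have hcompact : ∀ q ∈ S ×ˢ S', IsCompact (rect G G' h h' q) := fun q hq => by
    rw [← hmem] at hq
    refine IsCompact.prod ?_ ?_
    · refine (hG.isCompact_wordInterval hq.1.1).image_of_continuousOn
        (hh.contDiffOn.continuousOn.mono ?_)
      rintro _ ⟨x, hx, rfl⟩
      exact G.wordMap_mem hq.1.1 hx
    · refine (hG'.isCompact_wordInterval hq.2.1).image_of_continuousOn
        (hh'.contDiffOn.continuousOn.mono ?_)
      rintro _ ⟨x, hx, rfl⟩
      exact G'.wordMap_mem hq.2.1 hx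
  have hZ : ∀ p ∈ (S ×ˢ S') ×ˢ (S ×ˢ S'), MeasurableSet (Z p) := fun p hp => by
    rw [Finset.mem_product] at hp
    exact (isClosed_setOf_proj_inter (hcompact _ hp.1) (hcompact _ hp.2)).measurableSet
  have hinteg : ∀ p ∈ (S ×ˢ S') ×ˢ (S ×ˢ S'),
      Integrable ((Z p).indicator (1 : ℝ → ℝ)) (volume.restrict (Ioc (-R) R)) := fun p hp =>
    (integrable_const (1 : ℝ)).indicator (hZ p hp)
  have hRR : -R ≤ R := by linarith
  simp only [hN]
  refine ⟨fun s => hover s ▸ Finset.finite_toSet _, ?_, ?_⟩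
  · rw [intervalIntegrable_iff_integrableOn_Ioc_of_le hRR]
    exact integrable_finsetSum _ hinteg
  rw [intervalIntegral.integral_of_le hRR, integral_finsetSum _ hinteg]
  have hterm : ∀ p ∈ (S ×ˢ S') ×ˢ (S ×ˢ S'),
      ∫ s in Ioc (-R) R, (Z p).indicator (1 : ℝ → ℝ) s ≤ volume.real {s | s ∈ Icc (-R) R ∧
        |(h (G.wordMap p.1.1 0) - h (G.wordMap p.2.1 0)) -
          s * (h' (G'.wordMap p.1.2 0) - h' (G'.wordMap p.2.2 0))| ≤ E * ρ} := fun p hp => by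
    rw [integral_indicator_one (hZ p hp), measureReal_restrict_apply (hZ p hp)]
    refine measureReal_mono ?_ (measure_ne_top_of_subset (fun s hs => hs.1)
      (measure_Icc_lt_top (a := -R) (b := R)).ne)
    rintro s ⟨hs, hsR⟩
    have hsR' : s ∈ Icc (-R) R := ⟨hsR.1.le, hsR.2⟩
    rw [Finset.mem_product, ← hmem, ← hmem] at hp
    refine ⟨hsR', (abs_sub_le_of_proj_inter (abs_le.2 hsR')
      (x := (h (G.wordMap p.1.1 0), h' (G'.wordMap p.1.2 0)))
      (y := (h (G.wordMap p.2.1 0), h' (G'.wordMap p.2.2 0)))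
      (fun q hq => ⟨hball _ hp.1.1 _ hq.1, hball' _ hp.1.2 _ hq.2⟩)
      (fun q hq => ⟨hball _ hp.2.1 _ hq.1, hball' _ hp.2.2 _ hq.2⟩) hs).trans ?_⟩
    calc 2 * (L * ρ) + 2 * R * (L' * ρ) = (2 * L + 2 * R * L') * ρ := by ring
      _ ≤ E * ρ := by
        gcongr
        exact le_max_left _ _
  refine (Finset.sum_le_sum hterm).trans ?_
  have hsum := sum_volume_real_le S S' (fun c => h (G.wordMap c 0)) (fun c => h' (G'.wordMap c 0))
    hρ hE hR hC0 hC0' hdim'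
    (fun c hc τ hτ => by
      rw [card_filter_toFinset hS]
      exact hnear c (hS.mem_toFinset.1 hc) τ hτ)
    (fun c hc τ hτ => by
      rw [card_filter_toFinset hS']
      exact hnear' c (hS'.mem_toFinset.1 hc) τ hτ)
  refine hsum.trans ?_
  rw [ncard_eq_toFinset_card _ hS] at hcard
  rw [ncard_eq_toFinset_card _ hS'] at hcard'
  calc M * (S.card * S'.card) ≤ M * ((C * ρ ^ (-G.HD.toReal)) * (C' * ρ ^ (-G'.HD.toReal))) := by
        gcongr
    _ = M * (C * C') * ρ ^ (-G.HD.toReal - G'.HD.toReal) := by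
        rw [sub_eq_add_neg, Real.rpow_add hρ]
        ring
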